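/- Let $q=e^{2\pi i z}$ with $\operatorname{Im} z>0$, let $\eta(z)=q^{1/24}\prod_{n\ge1}(1-q^n)$ and $E_2(z)=1-24\sum_{n\ge1}\sigma_1(n)q^n$, where $\sigma_1(n)=\sum_{d\mid n}d$. Let $t\in\{5,7,13\}$ and put $$\mathcal{E}_{2,t}(z)=\frac{1}{t-1}\bigl(t\,E_2(tz)-E_2(z)\bigr),\qquad G_t(z)=\left(\frac{\eta(z)}{\eta(tz)}\right)^{24/(t-1)}.$$ Let $m$ be a negative integer with $24m\not\equiv1\pmod t$, let $k_1,\dots,k_{-m-1}$ be complex constants, put $$K(z)=G_t(z)^{-m}+\sum_{j=1}^{-m-1}k_j\,G_t(z)^j,$$ and define the coefficients $\beta_t(n)$, $n\ge m$, by $$\sum_{n=m}^{\infty}\beta_t(n)\,q^{n-\frac1{24}}=\mathcal{E}_{2,t}(z)\,\frac{K(z)}{\eta(z)}\qquad(\operatorname{Im} z>0).$$ Suppose that the constants $k_j$ are chosen so that $\beta_t(n)=0$ for $m+1\le n\le-1$. Then, for every integer $n\ge m$, $$\beta_t(n)=0\quad\text{whenever}\quad\left(\frac{1-24n}{t}\right)=-\left(\frac{1-24m}{t}\right),$$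 where $\left(\frac{\cdot}{t}\right)$ is the Legendre symbol. -/

import Mathlib

open UpperHalfPlane

noncomputable section

namespace EisensteinEta

/-- The point `t z` of the upper half-plane, for a positive integer `t`. -/
def mulPoint (t : ℕ) [NeZero t] (z : ℍ) : ℍ :=
  ⟨(t : ℂ) * (z : ℂ), by
    have ht : (0 : ℝ) < (t : ℝ) := Nat.cast_pos.mpr (NeZero.pos t)
    simpa using mul_pos ht z.im_pos⟩

/-- The weight two Eisenstein series `(t E₂(tz) - E₂(z)) / (t - 1)` of level `t`.
Here `EisensteinSeries.E2` is normalized to have constant term one,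
that is, `E₂ = 1 - 24 ∑ σ₁(n) qⁿ`. -/
def eisTwo (t : ℕ) [NeZero t] (z : ℍ) : ℂ :=
  1 / ((t : ℂ) - 1) *
    ((t : ℂ) * EisensteinSeries.E2 (mulPoint t z) - EisensteinSeries.E2 z)

/-- The Hauptmodul `(η(z) / η(tz)) ^ (24 / (t - 1))` of level `t`, for `t = 5, 7, 13`
(where the natural number division in the exponent is exact, with values `6, 4, 2`). -/
def hauptmodul (t : ℕ) [NeZero t] (z : ℍ) : ℂ :=
  (ModularForm.eta (z : ℂ) / ModularForm.eta (mulPoint t z : ℂ)) ^ (24 / (t - 1))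

/-- The polynomial `G ^ (-m) + ∑_{1 ≤ j ≤ -m-1} k_j G ^ j` in the Hauptmodul `G` of level `t`,
for a negative integer `m`. -/
def hauptmodulPoly (t : ℕ) [NeZero t] (m : ℤ) (k : ℤ → ℂ) (z : ℍ) : ℂ :=
  hauptmodul t z ^ (-m) + ∑ j ∈ Finset.Icc (1 : ℤ) (-m - 1), k j * hauptmodul t z ^ j

/-- `q ^ (n - 1/24)`, where `q = exp (2 π i z)`. -/
def qShift (n : ℤ) (z : ℍ) : ℂ :=
  Complex.exp (2 * (Real.pi : ℂ) * Complex.I * ((n : ℂ) - 1 / 24) * (z : ℂ))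

/-- The expansion `∑_{n ≥ m} β(n) q ^ (n - 1/24)` converges to `F` on the upper half-plane. -/
def HasShiftedExpansion (F : ℍ → ℂ) (m : ℤ) (β : ℤ → ℂ) : Prop :=
  ∀ z : ℍ, HasSum (fun n : {n : ℤ // m ≤ n} => β n * qShift n z) (F z)

end EisensteinEta

end

noncomputable section

namespace EisensteinEta

open Complex hiding I eta
open ModularForm ModularGroup Filter Topology
open scoped MatrixGroups Manifold

/-! The weight 3/2 function `eisTwo * hauptmodulPoly / eta` has conjugates under SL₂(ℤ) indexed by
the projective line over ℤ/t, modelled by `Option (ZMod t)`. Up to scalars they are `formCusp p /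
etaCusp p`. The modular group permutes the numerators in weight 2 and the eta functions `etaCusp p`
up to a multiplier ν. For t = 5, 7, 13 this ν is a constant times the Legendre symbol χ on nonzero x
(`EtaMultiplier.eq_quadChar`). Therefore the Paley matrix C on the projective line intertwines the
action (`conf_inv`), and with D = 1 - lC the functions `etaCusp p * ∑ D p p' * formCusp p' / etaCusp
p'` form a family of weight 2 that is honestly permuted.

Put ε = χ(1 - 24m) and normalise l by a Gauss sum. The finite points then contribute to the member
at 0 the coefficients β(n)(1 - ε χ(1 - 24n)) (`hasShiftedExpansion_proj`). The term n = m dies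
because ε² = 1, and the other polar terms vanish by the choice of the k_j, so this member is
bounded. The member at ∞ tends to 0. Multiplying by a power of the Hauptmodul and summing over the
projective line gives a level one form of weight 2, which must be 0; this forces the family to
vanish (`eventually_eq_zero_of_permuted`).

Thus the series with coefficients β(n)(1 - ε χ(1 - 24n)) equals the contribution of ∞, which is
invariant under w ↦ w + 24/t and so involves only n with t ∣ 24n - 1. If χ(1 - 24n) = -ε, the
coefficient is 2β(n) and t ∤ 24n - 1, whence β(n) = 0. -/

/-- `exp (2 π i x)`. -/
def expo (x : ℂ) : ℂ := cexp (2 * (Real.pi : ℂ) * Complex.I * x)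

lemma expo_add (x y : ℂ) : expo (x + y) = expo x * expo y := by
  simp only [expo, mul_add, Complex.exp_add]

lemma expo_zero : expo 0 = 1 := by simp [expo]

lemma expo_ne_zero (x : ℂ) : expo x ≠ 0 := Complex.exp_ne_zero _

lemma expo_neg (x : ℂ) : expo (-x) = (expo x)⁻¹ := by
  simp only [expo, mul_neg, Complex.exp_neg]

lemma expo_sub (x y : ℂ) : expo (x - y) = expo x / expo y := by
  rw [sub_eq_add_neg, expo_add, expo_neg, div_eq_mul_inv]

lemma expo_pow (x : ℂ) (n : ℕ) : expo x ^ n = expo (n * x) := by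
  rw [expo, ← Complex.exp_nat_mul, expo]; ring_nf

lemma expo_int (n : ℤ) : expo n = 1 := by
  rw [expo, ← Complex.exp_int_mul_two_pi_mul_I n]; ring_nf

lemma norm_expo (x : ℂ) : ‖expo x‖ = Real.exp (-2 * Real.pi * x.im) := by
  rw [expo, Complex.norm_exp]; simp

/-! ### Transformation laws of η and its size at infinity. -/

lemma eta_add_int (z : ℂ) (n : ℤ) : eta (z + n) = expo ((n : ℂ) / 24) * eta z := by
  have h1 : Function.Periodic.qParam 1 (z + n) = Function.Periodic.qParam 1 z := by
    simp only [Function.Periodic.qParam]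
    rw [Complex.exp_eq_exp_iff_exists_int]
    exact ⟨n, by push_cast; ring⟩
  simp only [eta, eta_q, h1]
  rw [← mul_assoc]
  congr 1
  simp only [Function.Periodic.qParam, expo]
  rw [← Complex.exp_add]
  congr 1; push_cast; ring

lemma coe_S_smul (z : ℍ) : ((S • z : ℍ) : ℂ) = -1 / (z : ℂ) := by
  rw [modular_S_smul]; simp [neg_div]

lemma coe_T_smul (z : ℍ) : ((T • z : ℍ) : ℂ) = (z : ℂ) + 1 := by
  rw [modular_T_smul]; simp [add_comm]

/-- The automorphy factor `(z / i) ^ (1 / 2)` of the Dedekind eta function. -/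
def etaFactor (z : ℂ) : ℂ := (sqrt Complex.I)⁻¹ * sqrt z

lemma eta_S_smul (z : ℍ) : eta ((S • z : ℍ) : ℂ) = etaFactor z * eta z := by
  rw [coe_S_smul]
  have := eta_comp_eq_csqrt_I_inv z.2
  simpa [etaFactor, mul_assoc] using this

lemma etaFactor_ne_zero (z : ℍ) : etaFactor z ≠ 0 := by
  intro h
  exact eta_ne_zero (S • z).2 (by rw [show ((S • z : ℍ) : ℂ) = _ from rfl, eta_S_smul, h, zero_mul])

lemma eta_coe_ne_zero (z : ℍ) : eta (z : ℂ) ≠ 0 := eta_ne_zero z.2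

lemma S_smul_S_smul (z : ℍ) : S • S • z = z := by
  ext1; rw [coe_S_smul, coe_S_smul]; have := z.ne_zero; field_simp

lemma etaFactor_mul_etaFactor_S (z : ℍ) : etaFactor ((S • z : ℍ) : ℂ) * etaFactor z = 1 := by
  have h := eta_S_smul (S • z)
  rw [S_smul_S_smul, eta_S_smul, ← mul_assoc] at h
  exact mul_right_cancel₀ (eta_coe_ne_zero z) (by rw [← h, one_mul])

lemma etaFactor_pow (z : ℍ) : etaFactor z ^ 24 = (z : ℂ) ^ 12 := by
  have h1 (w : ℂ) (hw : w ≠ 0) : sqrt w ^ 24 = w ^ 12 := by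
    rw [sqrt_eq_exp hw, ← Complex.exp_nat_mul]
    ring_nf
    rw [show (Complex.log w * 12) = (12 : ℕ) * Complex.log w by ring, Complex.exp_nat_mul,
      Complex.exp_log hw]
  rw [etaFactor, mul_pow, inv_pow, h1 _ Complex.I_ne_zero, h1 _ z.ne_zero,
    show 12 = 4 * 3 by rfl, pow_mul Complex.I, Complex.I_pow_four]
  simp

lemma etaFactor_mul_nat {t : ℕ} (ht : 0 < t) (z : ℍ) :
    etaFactor (t * z) = (Real.sqrt t : ℂ) * etaFactor z := by
  have ht' : 0 < (t : ℝ) := by exact_mod_cast ht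
  have h1 : (Real.sqrt t : ℂ) = cexp ((Real.log t : ℂ) / 2) := by
    rw [show ((Real.log t : ℂ) / 2) = ((Real.log t / 2 : ℝ) : ℂ) by push_cast; ring,
      ← Complex.ofReal_exp, Real.exp_half, Real.exp_log ht']
  have h2 : sqrt ((t : ℂ) * z) = (Real.sqrt t : ℂ) * sqrt (z : ℂ) := by
    rw [sqrt_eq_exp (mul_ne_zero (by exact_mod_cast ht.ne') z.ne_zero), sqrt_eq_exp z.ne_zero, h1,
      show ((t : ℂ)) = ((t : ℝ) : ℂ) by simp, Complex.log_ofReal_mul ht' z.ne_zero,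
      ← Complex.exp_add]
    congr 1; ring
  rw [etaFactor, h2, etaFactor]; ring

lemma continuous_etaFactor : Continuous fun z : ℍ => etaFactor z := by
  refine continuous_const.mul ?_
  rw [continuous_iff_continuousAt]
  intro z
  exact ((differentiableAt_sqrt (mem_slitPlane z)).continuousAt).comp
    UpperHalfPlane.continuous_coe.continuousAt

/-- This is the modularity of the discriminant η²⁴ in weight 12. -/
lemma eta_smul_pow (γ : SL(2, ℤ)) (z : ℍ) :
    eta ((γ • z : ℍ) : ℂ) ^ 24 = denom γ z ^ 12 * eta z ^ 24 := by
  have h := congrFun (SlashInvariantForm.slash_action_generators_SL2Z discriminant_S_invariant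
    discriminant_T_invariant γ) z
  rw [SL_slash_apply] at h
  simp only [discriminant] at h
  have hd := denom_ne_zero (γ : GL (Fin 2) ℝ) z
  rw [← h, mul_comm, mul_assoc, show (-12 : ℤ) = -((12 : ℕ) : ℤ) by rfl, zpow_neg, zpow_natCast]
  field_simp

lemma tendsto_eta_div_expo :
    Tendsto (fun z : ℍ => eta z / expo ((z : ℂ) / 24)) atImInfty (𝓝 1) := by
  have htprod : Tendsto (fun q : ℂ ↦ ∏' (n : ℕ), (1 - q ^ (n + 1))) (𝓝 0) (𝓝 1) := by
    have := tendsto_tprod_one_add_of_dominated_convergence (𝓕 := 𝓝 0) (g := 0)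
      (f := fun (q : ℂ) (n : ℕ) ↦ -q ^ (n + 1)) (bound := fun n ↦ (1 / 2 : ℝ) ^ (n + 1))
    simp only [Pi.zero_apply, norm_neg, norm_pow, add_zero, tprod_one] at this
    simp_rw [sub_eq_add_neg]
    refine this
      (by simpa only [pow_succ'] using (summable_geometric_of_abs_lt_one (by norm_num)).mul_left _)
      (fun k ↦ by simpa using ((continuous_pow (M := ℂ) (k + 1)).tendsto 0).neg) ?_
    filter_upwards [Metric.ball_mem_nhds (0 : ℂ) (by norm_num : (0 : ℝ) < 1 / 2)] with q hq k
    exact pow_le_pow_left₀ (norm_nonneg _) (mem_ball_zero_iff.mp hq).le _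
  refine (htprod.comp (UpperHalfPlane.qParam_tendsto_atImInfty zero_lt_one)).congr fun z => ?_
  have : Function.Periodic.qParam 24 (z : ℂ) = expo ((z : ℂ) / 24) := by
    rw [expo, Function.Periodic.qParam]; push_cast; ring_nf
  rw [eta, this, mul_div_cancel_left₀ _ (expo_ne_zero _)]
  rfl

/-! ### Eta functions indexed by the projective line over ℤ/t. -/

/-- The point `(z + a) / t`. -/
def affPoint (t : ℕ) [NeZero t] (a : ℤ) (z : ℍ) : ℍ :=
  ⟨((z : ℂ) + a) / t, by
    have ht : (0 : ℝ) < (t : ℝ) := Nat.cast_pos.mpr (NeZero.pos t)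
    simpa [Complex.div_natCast_im] using div_pos z.im_pos ht⟩

lemma dvd_sq_sub_one {t : ℕ} (hc : t.Coprime 24) : (24 : ℤ) ∣ (t : ℤ) ^ 2 - 1 := by
  have h : ∀ n < 24, n.Coprime 24 → n ^ 2 % 24 = 1 := by decide
  have h1 := h (t % 24) (Nat.mod_lt _ (by norm_num))
    (by rw [Nat.Coprime, ← Nat.gcd_rec, Nat.gcd_comm]; exact hc)
  have h2 : t ^ 2 % 24 = 1 := by rw [Nat.pow_mod]; exact h1
  have h3 : ((t ^ 2 : ℕ) : ℤ) % 24 = 1 := by exact_mod_cast h2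
  push_cast at h3
  omega

variable (t : ℕ) [Fact t.Prime]

lemma coe_affPoint (a : ℤ) (z : ℍ) : (affPoint t a z : ℂ) = ((z : ℂ) + a) / t := rfl

lemma coe_mulPoint (z : ℍ) : (mulPoint t z : ℂ) = t * (z : ℂ) := rfl

lemma natCast_ne_zero : (t : ℂ) ≠ 0 := by
  exact_mod_cast (Fact.out : t.Prime).ne_zero

/-- An integral representative divisible by `24` of a residue class modulo `t`. -/
def lift24 (x : ZMod t) : ℤ := 24 * (((24 : ZMod t)⁻¹ * x).val : ℤ)

lemma dvd_lift24 (x : ZMod t) : 24 ∣ lift24 t x := Dvd.intro _ rfl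

variable {t}

lemma isUnit_24 (hc : t.Coprime 24) : (24 : ZMod t) ≠ 0 := by
  intro h
  have : ((24 : ℕ) : ZMod t) = 0 := by exact_mod_cast h
  rw [ZMod.natCast_eq_zero_iff] at this
  exact (Fact.out : t.Prime).one_lt.ne' (Nat.eq_one_of_dvd_coprimes hc dvd_rfl this)

lemma coe_lift24 (hc : t.Coprime 24) (x : ZMod t) : ((lift24 t x : ℤ) : ZMod t) = x := by
  rw [lift24]; push_cast
  rw [ZMod.natCast_zmod_val, mul_inv_cancel_left₀ (isUnit_24 hc)]

lemma lift24_zero : lift24 t 0 = 0 := by simp [lift24]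

variable (t) in
/-- The eta functions `√t η(t z)` and `η((z + x) / t)` attached to the points of the projective
line over `ℤ / t`. -/
def etaCusp : Option (ZMod t) → ℍ → ℂ
  | none, z => (Real.sqrt t : ℂ) * eta (mulPoint t z)
  | some x, z => eta (affPoint t (lift24 t x) z)

lemma sqrt_natCast_ne_zero : (Real.sqrt t : ℂ) ≠ 0 := by
  have : 0 < (t : ℝ) := by exact_mod_cast (Fact.out : t.Prime).pos
  exact_mod_cast (Real.sqrt_pos.mpr this).ne'

lemma etaCusp_ne_zero (p : Option (ZMod t)) (z : ℍ) : etaCusp t p z ≠ 0 := by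
  cases p with
  | none => exact mul_ne_zero sqrt_natCast_ne_zero (eta_coe_ne_zero _)
  | some x => exact eta_coe_ne_zero _

variable (t) in
/-- Translation by one on the projective line. -/
def shiftEquiv : Option (ZMod t) ≃ Option (ZMod t) := Equiv.optionCongr (Equiv.addRight 1)

variable (t) in
/-- The map `x ↦ -1 / x` on the projective line. -/
def invCusp : Option (ZMod t) → Option (ZMod t)
  | none => some 0
  | some x => if x = 0 then none else some (-x⁻¹)

lemma invCusp_invCusp (p : Option (ZMod t)) : invCusp t (invCusp t p) = p := by
  rcases p with _ | x
  · simp [invCusp]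
  · by_cases hx : x = 0 <;> simp [invCusp, hx, inv_neg]

variable (t) in
/-- The involution `x ↦ -1 / x` on the projective line, as an equivalence. -/
def invEquiv : Option (ZMod t) ≃ Option (ZMod t) :=
  ⟨invCusp t, invCusp t, invCusp_invCusp, invCusp_invCusp⟩

@[simp] lemma shiftEquiv_none : shiftEquiv t none = none := rfl
@[simp] lemma shiftEquiv_some (x : ZMod t) : shiftEquiv t (some x) = some (x + 1) := rfl
@[simp] lemma invEquiv_none : invEquiv t none = some 0 := rfl
@[simp] lemma invEquiv_zero : invEquiv t (some 0) = none := by simp [invEquiv, invCusp]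
lemma invEquiv_some {x : ZMod t} (hx : x ≠ 0) : invEquiv t (some x) = some (-x⁻¹) := by
  simp [invEquiv, invCusp, hx]
@[simp] lemma invEquiv_invEquiv (p : Option (ZMod t)) : invEquiv t (invEquiv t p) = p :=
  invCusp_invCusp p

/-- All points share one constant because the lifts are divisible by 24: if the lifts of x + 1 and x
differ by 1 + tk, then t² ≡ 1 mod 24 gives k ≡ -t mod 24. -/
lemma etaCusp_T (hc : t.Coprime 24) (p : Option (ZMod t)) (z : ℍ) :
    etaCusp t p (T • z) = expo ((t : ℂ) / 24) * etaCusp t (shiftEquiv t p) z := by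
  have ht := natCast_ne_zero t
  rcases p with _ | x
  · simp only [shiftEquiv_none, etaCusp, coe_mulPoint, coe_T_smul]
    rw [show (t : ℂ) * ((z : ℂ) + 1) = t * z + ((t : ℤ) : ℂ) by push_cast; ring, eta_add_int]
    push_cast; ring
  · have hd : (t : ℤ) ∣ lift24 t (x + 1) - lift24 t x - 1 := by
      rw [← ZMod.intCast_zmod_eq_zero_iff_dvd]; push_cast; simp [coe_lift24 hc]
    obtain ⟨k, hk⟩ := hd
    have h24 : (24 : ℤ) ∣ t + k := by
      have h1 : (24 : ℤ) ∣ t * (t + k) := by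
        have h2 := dvd_add (dvd_sq_sub_one hc) (dvd_sub (dvd_lift24 t (x + 1)) (dvd_lift24 t x))
        rwa [show (t : ℤ) ^ 2 - 1 + (lift24 t (x + 1) - lift24 t x) = t * (t + k) by
          rw [mul_add, ← hk]; ring] at h2
      exact IsCoprime.dvd_of_dvd_mul_left
        (by exact_mod_cast (Nat.isCoprime_iff_coprime.mpr hc.symm)) h1
    obtain ⟨l, hl⟩ := h24
    have hz : ((affPoint t (lift24 t x) (T • z) : ℍ) : ℂ) =
        (affPoint t (lift24 t (x + 1)) z : ℂ) + ((-k : ℤ) : ℂ) := by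
      rw [coe_affPoint, coe_affPoint, coe_T_smul,
        show lift24 t (x + 1) = lift24 t x + 1 + t * k by linarith]
      push_cast; field_simp; ring
    simp only [shiftEquiv_some, etaCusp]
    rw [hz, eta_add_int, show (((-k : ℤ) : ℂ) / 24) = (t : ℂ) / 24 + ((-l : ℤ) : ℂ) by
      rw [show k = 24 * l - t by linarith]; push_cast; field_simp; ring, expo_add, expo_int, mul_one]

/-- The matrix relating `(-1 / z + x) / t` to `(z - 1 / x) / t`. -/
lemma exists_smul_affPoint (hc : t.Coprime 24) {x : ZMod t} (hx : x ≠ 0) :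
    ∃ γ : SL(2, ℤ), γ 1 0 = t ∧ ∀ z : ℍ,
      affPoint t (lift24 t x) (S • z) = γ • affPoint t (lift24 t (-x⁻¹)) z ∧
      denom γ (affPoint t (lift24 t (-x⁻¹)) z) = z := by
  set a := lift24 t x
  set b := lift24 t (-x⁻¹)
  have hd : (t : ℤ) ∣ -1 - a * b := by
    rw [← ZMod.intCast_zmod_eq_zero_iff_dvd]; push_cast; simp [a, b, coe_lift24 hc, hx]
  obtain ⟨k, hk⟩ := hd
  have ht := natCast_ne_zero t
  have hkC : (-1 : ℂ) - a * b = t * k := by exact_mod_cast hk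
  let γ : SL(2, ℤ) := ⟨!![a, k; t, -b], by rw [Matrix.det_fin_two_of]; linarith⟩
  have hden (z : ℍ) : denom γ (affPoint t b z) = z := by
    rw [ModularGroup.denom_apply]
    simp [γ, coe_affPoint]
    field_simp; ring
  refine ⟨γ, rfl, fun z => ⟨?_, hden z⟩⟩
  ext1
  have hz := z.ne_zero
  have hden' := hden z
  rw [ModularGroup.denom_apply] at hden'
  rw [coe_specialLinearGroup_apply, coe_affPoint, coe_S_smul]
  simp [γ, coe_affPoint] at hden' ⊢
  rw [hden']
  field_simp
  linear_combination hkC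

lemma continuous_eta_coe : Continuous fun z : ℍ => eta z := by
  rw [continuous_iff_continuousAt]
  intro z
  exact (differentiableAt_eta_of_mem_upperHalfPlaneSet z.2).continuousAt.comp
    UpperHalfPlane.continuous_coe.continuousAt

lemma continuous_affPoint (a : ℤ) : Continuous (affPoint t a) := by
  rw [UpperHalfPlane.isEmbedding_coe.continuous_iff]
  exact (UpperHalfPlane.continuous_coe.add continuous_const).div_const _

lemma continuous_S_smul : Continuous fun z : ℍ => S • z := by
  rw [UpperHalfPlane.isEmbedding_coe.continuous_iff]
  exact (continuous_const.div UpperHalfPlane.continuous_coe fun z => z.ne_zero).congr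
    fun z => (coe_S_smul z).symm

lemma eq_of_pow_eq_one {f : ℍ → ℂ} (hf : Continuous f) {n : ℕ} (hn : 0 < n)
    (h : ∀ z, f z ^ n = 1) (z w : ℍ) : f z = f w := by
  classical
  refine isPreconnected_univ.constant_of_mapsTo
    (T := (((Polynomial.nthRoots n (1 : ℂ)).toFinset : Finset ℂ) : Set ℂ))
    (Finset.finite_toSet _).isDiscrete hf.continuousOn (fun z _ => ?_) (Set.mem_univ z)
    (Set.mem_univ w)
  simp [Polynomial.mem_nthRoots hn, h]

lemma coe_mulPoint_S (z : ℍ) : mulPoint t (S • z) = S • affPoint t 0 z := by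
  ext1
  rw [coe_mulPoint, coe_S_smul, coe_S_smul, coe_affPoint]
  have := natCast_ne_zero t
  have := z.ne_zero
  simp; field_simp

lemma affPoint_zero_S (z : ℍ) : affPoint t 0 (S • z) = S • mulPoint t z := by
  ext1
  rw [coe_S_smul, coe_affPoint, coe_S_smul, coe_mulPoint]
  have := natCast_ne_zero t
  have := z.ne_zero
  simp; field_simp

/-- At ∞ and 0 the law follows directly from that of η under S. Elsewhere the 24th power of the
quotient of the two sides is 1 by modularity of η²⁴, and a continuous function with values in the
roots of unity of order dividing 24 is constant on ℍ. -/
lemma exists_etaMultiplier (hc : t.Coprime 24) : ∃ ν : Option (ZMod t) → ℂ,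
    ν none = 1 ∧ ν (some 0) = 1 ∧ ∀ p z,
      etaCusp t p (S • z) = ν p * etaFactor z * etaCusp t (invEquiv t p) z := by
  have key (p : Option (ZMod t)) : ∃ c : ℂ, (p = none → c = 1) ∧ (p = some 0 → c = 1) ∧ ∀ z,
      etaCusp t p (S • z) = c * etaFactor z * etaCusp t (invEquiv t p) z := by
    rcases p with _ | x
    · refine ⟨1, by simp, by simp, fun z => ?_⟩
      have h : etaFactor z = (Real.sqrt t : ℂ) * etaFactor (affPoint t 0 z) := by
        rw [← etaFactor_mul_nat (Fact.out : t.Prime).pos, coe_affPoint]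
        congr 1
        have := natCast_ne_zero t
        simp; field_simp
      rw [invEquiv_none, etaCusp, etaCusp, coe_mulPoint_S, eta_S_smul, lift24_zero, h]
      ring
    · by_cases hx : x = 0
      · subst hx
        refine ⟨1, by simp, by simp, fun z => ?_⟩
        rw [invEquiv_zero, etaCusp, etaCusp, lift24_zero, affPoint_zero_S, eta_S_smul, coe_mulPoint,
          etaFactor_mul_nat (Fact.out : t.Prime).pos]
        ring
      · obtain ⟨γ, -, hγ⟩ := exists_smul_affPoint hc hx
        set f : ℍ → ℂ := fun z =>
          etaCusp t (some x) (S • z) / (etaFactor z * etaCusp t (invEquiv t (some x)) z) with hf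
        have h0 (z : ℍ) : etaFactor z * etaCusp t (invEquiv t (some x)) z ≠ 0 :=
          mul_ne_zero (etaFactor_ne_zero z) (etaCusp_ne_zero _ _)
        have h1 (z : ℍ) : f z ^ 24 = 1 := by
          rw [hf]; dsimp only
          rw [div_pow, div_eq_one_iff_eq (pow_ne_zero _ (h0 z)), mul_pow, etaFactor_pow,
            invEquiv_some hx, etaCusp, etaCusp, (hγ z).1, eta_smul_pow, (hγ z).2]
        have h2 : Continuous f := by
          refine Continuous.div ?_ (continuous_etaFactor.mul ?_) h0
          · exact (continuous_eta_coe.comp (continuous_affPoint _)).comp continuous_S_smul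
          · rw [invEquiv_some hx]
            exact continuous_eta_coe.comp (continuous_affPoint _)
        refine ⟨f UpperHalfPlane.I, by simp, by simp [hx], fun z => ?_⟩
        rw [eq_of_pow_eq_one h2 (by norm_num) h1 UpperHalfPlane.I z, mul_assoc, hf]
        exact (div_mul_cancel₀ _ (h0 z)).symm
  choose ν h using key
  exact ⟨ν, (h none).1 rfl, (h (some 0)).2.1 rfl, fun p => (h p).2.2⟩

/-! ### Computation of the multiplier from elliptic points. -/

/-- The values `ν` satisfy the relations coming from the elliptic points and the presentation of
the modular group. -/
structure EtaMultiplier (c : ℂ) (ν : ZMod t → ℂ) : Prop where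
  mul_inv : ∀ x y, x * y = -1 → ν x * ν y = 1
  fix_S : ∀ x, x * x = -1 → ν x = 1
  one : c ^ 3 * ν 1 = 1
  fix_ST : ∀ x, x * x = x - 1 → c * ν x = 1
  cycle : ∀ x y z, x * y = x - 1 → y * z = y - 1 → x ≠ 0 → y ≠ 0 →
    c ^ 3 * (ν x * ν y * ν z) = 1

lemma S_smul_I : S • UpperHalfPlane.I = UpperHalfPlane.I := by
  ext1; rw [coe_S_smul]; simp [UpperHalfPlane.coe_I]

lemma S_smul_T_smul_rho : S • T • UpperHalfPlane.ρ = UpperHalfPlane.ρ := by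
  ext1
  have h : (UpperHalfPlane.ρ : ℂ) * (UpperHalfPlane.ρ : ℂ) + (UpperHalfPlane.ρ : ℂ) + 1 = 0 := by
    have h3 : Real.sqrt 3 * Real.sqrt 3 = 3 := Real.mul_self_sqrt (by norm_num)
    simp only [UpperHalfPlane.ρ]
    apply Complex.ext <;> simp <;> nlinarith
  have h0 := (T • UpperHalfPlane.ρ).ne_zero
  rw [coe_S_smul, div_eq_iff h0, coe_T_smul]
  linear_combination -h

/-- The nonvanishing of η lets the transformation laws be evaluated at fixed points: i for S and ρ
for ST. On the projective line ST induces x ↦ 1 - 1/x, of order 3. Its fixed points give `fix_ST`,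
the orbit ∞ → 1 → 0 gives `one`, and other orbits give `cycle`. -/
lemma etaMultiplier_of_transform (hc : t.Coprime 24) {ν : Option (ZMod t) → ℂ}
    (h1 : ν none = 1) (h0 : ν (some 0) = 1)
    (h : ∀ p z, etaCusp t p (S • z) = ν p * etaFactor z * etaCusp t (invEquiv t p) z) :
    EtaMultiplier (expo (((t : ℂ) - 1) / 24)) (fun x => ν (some x)) := by
  set c := expo (((t : ℂ) - 1) / 24) with hcdef
  have hinv (p) : ν p * ν (invEquiv t p) = 1 := by
    have h2 := h p (S • UpperHalfPlane.I)
    rw [S_smul_S_smul, h, invEquiv_invEquiv] at h2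
    have h3 := etaFactor_mul_etaFactor_S UpperHalfPlane.I
    refine mul_right_cancel₀ (etaCusp_ne_zero p UpperHalfPlane.I) ?_
    linear_combination (-ν p * ν (invEquiv t p) * etaCusp t p UpperHalfPlane.I) * h3 - h2
  have hρ (p) : etaCusp t p UpperHalfPlane.ρ =
      c * ν p * etaCusp t (shiftEquiv t (invEquiv t p)) UpperHalfPlane.ρ := by
    have h2 := h p (T • UpperHalfPlane.ρ)
    have h3 := eta_S_smul (T • UpperHalfPlane.ρ)
    rw [S_smul_T_smul_rho, etaCusp_T hc] at h2
    rw [S_smul_T_smul_rho, coe_T_smul, show ((1 : ℂ)) = ((1 : ℤ) : ℂ) by simp, eta_add_int] at h3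
    -- The automorphy factor at ρ is read off from η itself, so no branch of the square root has to
    -- be evaluated.
    have h4 : etaFactor ((T • UpperHalfPlane.ρ : ℍ) : ℂ) * expo (1 / 24) = 1 := by
      refine mul_right_cancel₀ (eta_coe_ne_zero UpperHalfPlane.ρ) ?_
      rw [coe_T_smul]
      push_cast at h3 ⊢
      linear_combination -h3
    have h5 : expo ((t : ℂ) / 24) = c * expo (1 / 24) := by
      rw [hcdef, ← expo_add]; congr 1; ring
    rw [h2, h5]
    linear_combination (ν p * c *
      etaCusp t (shiftEquiv t (invEquiv t p)) UpperHalfPlane.ρ) * h4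
  have hst {x y : ZMod t} (hx : x ≠ 0) (hxy : x * y = x - 1) :
      shiftEquiv t (invEquiv t (some x)) = some y := by
    rw [invEquiv_some hx, shiftEquiv_some]
    congr 1
    refine mul_left_cancel₀ hx ?_
    rw [hxy]; field_simp; ring
  have hρ' {x y : ZMod t} (hx : x ≠ 0) (hxy : x * y = x - 1) :
      etaCusp t (some x) UpperHalfPlane.ρ = c * ν (some x) * etaCusp t (some y) UpperHalfPlane.ρ := by
    rw [hρ, hst hx hxy]
  have hρn : etaCusp t none UpperHalfPlane.ρ = c * etaCusp t (some 1) UpperHalfPlane.ρ := by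
    rw [hρ, h1]; simp
  have hρ0 : etaCusp t (some 0) UpperHalfPlane.ρ = c * etaCusp t none UpperHalfPlane.ρ := by
    rw [hρ, h0]; simp
  have hone : (1 : ZMod t) ≠ 0 := one_ne_zero
  refine ⟨fun x y hxy => ?_, fun x hx => ?_, ?_, fun x hx => ?_, fun x y z hxy hyz hx hy => ?_⟩
  · have hx : x ≠ 0 := by rintro rfl; simp at hxy
    have := hinv (some x)
    rwa [invEquiv_some hx, show -x⁻¹ = y by
      refine mul_left_cancel₀ hx ?_
      rw [hxy]; field_simp] at this
  · have hx0 : x ≠ 0 := by rintro rfl; simp at hx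
    have h2 := h (some x) UpperHalfPlane.I
    have h3 := eta_S_smul UpperHalfPlane.I
    rw [S_smul_I, invEquiv_some hx0, show -x⁻¹ = x by
      refine mul_left_cancel₀ hx0 ?_
      rw [hx]; field_simp] at h2
    rw [S_smul_I] at h3
    have h4 : etaFactor (UpperHalfPlane.I : ℂ) = 1 :=
      mul_right_cancel₀ (eta_coe_ne_zero UpperHalfPlane.I) (by rw [← h3, one_mul])
    rw [h4, mul_one] at h2
    exact mul_right_cancel₀ (etaCusp_ne_zero (some x) UpperHalfPlane.I)
      (by rw [one_mul]; exact h2.symm)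
  · refine mul_right_cancel₀ (etaCusp_ne_zero (t := t) (some 1) UpperHalfPlane.ρ) ?_
    have h2 := hρ' (x := (1 : ZMod t)) (y := 0) hone (by ring)
    rw [hρ0, hρn] at h2
    linear_combination -h2
  · have hx0 : x ≠ 0 := by
      rintro rfl; simp at hx
    have h2 := hρ' hx0 hx
    exact (mul_right_cancel₀ (etaCusp_ne_zero (some x) UpperHalfPlane.ρ)
      (by rw [← h2, one_mul]))
  · refine mul_right_cancel₀ (etaCusp_ne_zero (t := t) (some x) UpperHalfPlane.ρ) ?_
    have hz : z ≠ 0 := by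
      rintro rfl
      have : y = 1 := by linear_combination -hyz
      rw [this] at hxy; exact one_ne_zero (by linear_combination hxy : (1 : ZMod t) = 0)
    have hzx : z * x = z - 1 := by
      refine mul_left_cancel₀ hy ?_
      linear_combination (x - 1) * hyz + hxy
    have h2 := hρ' hx hxy
    rw [hρ' hy hyz, hρ' hz hzx] at h2
    linear_combination -h2

/-! ### The multiplier as a quadratic character. -/

variable (t) in
/-- The quadratic character modulo `t`, with complex values. -/
def quadChar : MulChar (ZMod t) ℂ := (quadraticChar (ZMod t)).ringHomComp (Int.castRingHom ℂ)

lemma quadChar_apply (x : ZMod t) : quadChar t x = ((quadraticChar (ZMod t) x : ℤ) : ℂ) := rfl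

lemma quadChar_eq_one {x : ZMod t} (hx : x ≠ 0) (h : IsSquare x) : quadChar t x = 1 := by
  rw [quadChar_apply, (quadraticChar_one_iff_isSquare hx).mpr h]; simp

lemma quadChar_eq_neg_one {x : ZMod t} (h : ¬ IsSquare x) : quadChar t x = -1 := by
  rw [quadChar_apply, quadraticChar_neg_one_iff_not_isSquare.mpr h]; simp

lemma expo_half : expo (1 / 2) = -1 := by
  rw [expo, ← Complex.exp_pi_mul_I]; congr 1; ring

lemma expo_sixth_pow : expo (1 / 6) ^ 3 = -1 := by
  rw [expo_pow, ← expo_half]; congr 1; norm_num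

lemma expo_quarter : expo (1 / 4) = Complex.I := by
  rw [expo, show 2 * (Real.pi : ℂ) * Complex.I * (1 / 4) = Real.pi / 2 * Complex.I by ring,
    Complex.exp_pi_div_two_mul_I]

instance fact_prime_five : Fact (Nat.Prime 5) := ⟨by norm_num⟩

/-- Here c = e(1/6), so ν 1 = -1, while 2 and 3 are the fixed points of x ↦ -1/x. -/
lemma EtaMultiplier.eq_quadChar_five {ν : ZMod 5 → ℂ}
    (h : EtaMultiplier (expo (((5 : ℕ) - 1 : ℂ) / 24)) ν) :
    (∀ x, x ≠ 0 → ν x = ν 1 * quadChar 5 x) ∧ ν 1 ^ (24 / (5 - 1)) = 1 ∧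
      ν 1 ^ 2 = quadChar 5 (-1) := by
  have h1 := h.one
  rw [show (((5 : ℕ) : ℂ) - 1) / 24 = 1 / 6 by norm_num, expo_sixth_pow] at h1
  have e1 : ν 1 = -1 := by linear_combination -h1
  have e2 : ν 2 = 1 := h.fix_S 2 (by decide)
  have e3 : ν 3 = 1 := h.fix_S 3 (by decide)
  have e4 : ν 4 = -1 := by
    have := h.mul_inv 1 4 (by decide); rw [e1] at this; linear_combination -this
  have c1 : quadChar 5 1 = 1 := quadChar_eq_one (by decide) (by decide)
  have c4 : quadChar 5 4 = 1 := quadChar_eq_one (by decide) (by decide)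
  have c2 : quadChar 5 2 = -1 := quadChar_eq_neg_one (by decide)
  have c3 : quadChar 5 3 = -1 := quadChar_eq_neg_one (by decide)
  refine ⟨?_, by rw [e1]; norm_num, by rw [e1, show (-1 : ZMod 5) = 4 by decide, c4]; norm_num⟩
  intro x hx
  have : x = 1 ∨ x = 2 ∨ x = 3 ∨ x = 4 := by revert x; decide
  rcases this with rfl | rfl | rfl | rfl <;> simp [*]

instance fact_prime_seven : Fact (Nat.Prime 7) := ⟨by norm_num⟩

/-- Here c = e(1/4) = i; the points 3 and 5 are fixed by x ↦ 1 - 1/x, and inversion gives the rest.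
-/
lemma EtaMultiplier.eq_quadChar_seven {ν : ZMod 7 → ℂ}
    (h : EtaMultiplier (expo (((7 : ℕ) - 1 : ℂ) / 24)) ν) :
    (∀ x, x ≠ 0 → ν x = ν 1 * quadChar 7 x) ∧ ν 1 ^ (24 / (7 - 1)) = 1 ∧
      ν 1 ^ 2 = quadChar 7 (-1) := by
  have h1 := h.one
  have hfix := h.fix_ST
  rw [show (((7 : ℕ) : ℂ) - 1) / 24 = 1 / 4 by norm_num, expo_quarter] at h1 hfix
  have hI := Complex.I_mul_I
  have e1 : ν 1 = Complex.I := by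
    rw [Complex.I_pow_three] at h1; linear_combination Complex.I * h1 + ν 1 * hI
  have inv {x : ZMod 7} (h : Complex.I * ν x = 1) : ν x = -Complex.I := by
    linear_combination -Complex.I * h + ν x * hI
  have e3 : ν 3 = -Complex.I := inv (hfix 3 (by decide))
  have e5 : ν 5 = -Complex.I := inv (hfix 5 (by decide))
  have e2 : ν 2 = Complex.I := by
    have := h.mul_inv 3 2 (by decide); rw [e3] at this
    linear_combination Complex.I * this + ν 2 * hI
  have e4 : ν 4 = Complex.I := by
    have := h.mul_inv 5 4 (by decide); rw [e5] at this
    linear_combination Complex.I * this + ν 4 * hI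
  have e6 : ν 6 = -Complex.I := by
    have := h.mul_inv 1 6 (by decide); rw [e1] at this; exact inv this
  have c1 : quadChar 7 1 = 1 := quadChar_eq_one (by decide) (by decide)
  have c2 : quadChar 7 2 = 1 := quadChar_eq_one (by decide) (by decide)
  have c4 : quadChar 7 4 = 1 := quadChar_eq_one (by decide) (by decide)
  have c3 : quadChar 7 3 = -1 := quadChar_eq_neg_one (by decide)
  have c5 : quadChar 7 5 = -1 := quadChar_eq_neg_one (by decide)
  have c6 : quadChar 7 6 = -1 := quadChar_eq_neg_one (by decide)
  refine ⟨?_, by rw [e1]; norm_num [Complex.I_pow_four],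
    by rw [e1, show (-1 : ZMod 7) = 6 by decide, c6]; simp⟩
  intro x hx
  have : x = 1 ∨ x = 2 ∨ x = 3 ∨ x = 4 ∨ x = 5 ∨ x = 6 := by revert x; decide
  rcases this with rfl | rfl | rfl | rfl | rfl | rfl <;> simp [*]

instance fact_prime_thirteen : Fact (Nat.Prime 13) := ⟨by norm_num⟩

/-- Here c = -1; the fixed points 4, 10 and 5, 8 do not suffice, so two orbits of length 3 are
needed as well. -/
lemma EtaMultiplier.eq_quadChar_thirteen {ν : ZMod 13 → ℂ}
    (h : EtaMultiplier (expo (((13 : ℕ) - 1 : ℂ) / 24)) ν) :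
    (∀ x, x ≠ 0 → ν x = ν 1 * quadChar 13 x) ∧ ν 1 ^ (24 / (13 - 1)) = 1 ∧
      ν 1 ^ 2 = quadChar 13 (-1) := by
  have h1 := h.one
  have hfix := h.fix_ST
  have hcyc := h.cycle
  rw [show (((13 : ℕ) : ℂ) - 1) / 24 = 1 / 2 by norm_num, expo_half] at h1 hfix hcyc
  have e1 : ν 1 = -1 := by linear_combination -h1
  have inv {x y : ZMod 13} (h1 : ν x = -1) (h2 : ν x * ν y = 1) : ν y = -1 := by
    rw [h1] at h2; linear_combination -h2
  have inv' {x y : ZMod 13} (h1 : ν x = 1) (h2 : ν x * ν y = 1) : ν y = 1 := by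
    rwa [h1, one_mul] at h2
  have e12 : ν 12 = -1 := inv e1 (h.mul_inv 1 12 (by decide))
  have e4 : ν 4 = -1 := by linear_combination -hfix 4 (by decide)
  have e10 : ν 10 = -1 := by linear_combination -hfix 10 (by decide)
  have e3 : ν 3 = -1 := inv e4 (h.mul_inv 4 3 (by decide))
  have e9 : ν 9 = -1 := inv e10 (h.mul_inv 10 9 (by decide))
  have e5 : ν 5 = 1 := h.fix_S 5 (by decide)
  have e8 : ν 8 = 1 := h.fix_S 8 (by decide)
  have e6 : ν 6 = 1 := by
    have := hcyc 3 5 6 (by decide) (by decide) (by decide) (by decide)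
    rw [e3, e5] at this; linear_combination this
  have e2 : ν 2 = 1 := inv' e6 (h.mul_inv 6 2 (by decide))
  have e7 : ν 7 = 1 := by
    have := hcyc 2 7 12 (by decide) (by decide) (by decide) (by decide)
    rw [e2, e12] at this; linear_combination this
  have e11 : ν 11 = 1 := inv' e7 (h.mul_inv 7 11 (by decide))
  have c1 : quadChar 13 1 = 1 := quadChar_eq_one (by decide) (by decide)
  have c3 : quadChar 13 3 = 1 := quadChar_eq_one (by decide) (by decide)
  have c4 : quadChar 13 4 = 1 := quadChar_eq_one (by decide) (by decide)
  have c9 : quadChar 13 9 = 1 := quadChar_eq_one (by decide) (by decide)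
  have c10 : quadChar 13 10 = 1 := quadChar_eq_one (by decide) (by decide)
  have c12 : quadChar 13 12 = 1 := quadChar_eq_one (by decide) (by decide)
  have c2 : quadChar 13 2 = -1 := quadChar_eq_neg_one (by decide)
  have c5 : quadChar 13 5 = -1 := quadChar_eq_neg_one (by decide)
  have c6 : quadChar 13 6 = -1 := quadChar_eq_neg_one (by decide)
  have c7 : quadChar 13 7 = -1 := quadChar_eq_neg_one (by decide)
  have c8 : quadChar 13 8 = -1 := quadChar_eq_neg_one (by decide)
  have c11 : quadChar 13 11 = -1 := quadChar_eq_neg_one (by decide)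
  refine ⟨?_, by rw [e1]; norm_num, by rw [e1, show (-1 : ZMod 13) = 12 by decide, c12]; norm_num⟩
  intro x hx
  have : x = 1 ∨ x = 2 ∨ x = 3 ∨ x = 4 ∨ x = 5 ∨ x = 6 ∨ x = 7 ∨ x = 8 ∨ x = 9 ∨ x = 10 ∨
    x = 11 ∨ x = 12 := by revert x; decide
  rcases this with rfl | rfl | rfl | rfl | rfl | rfl | rfl | rfl | rfl | rfl | rfl | rfl <;>
    simp [*]

lemma EtaMultiplier.eq_quadChar (ht : t = 5 ∨ t = 7 ∨ t = 13) {ν : ZMod t → ℂ}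
    (h : EtaMultiplier (expo (((t : ℂ) - 1) / 24)) ν) :
    (∀ x, x ≠ 0 → ν x = ν 1 * quadChar t x) ∧ ν 1 ^ (24 / (t - 1)) = 1 ∧
      ν 1 ^ 2 = quadChar t (-1) := by
  rcases ht with rfl | rfl | rfl
  · exact h.eq_quadChar_five
  · exact h.eq_quadChar_seven
  · exact h.eq_quadChar_thirteen

/-! ### Holomorphy, level one forms of weight 2, and E₂. -/

/-- Holomorphy of a function on the upper half-plane. -/
def Hol (f : ℍ → ℂ) : Prop := DifferentiableOn ℂ (f ∘ ofComplex) upperHalfPlaneSet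

lemma Hol.of_coe {f : ℍ → ℂ} {h : ℂ → ℂ} (hh : DifferentiableOn ℂ h upperHalfPlaneSet)
    (hf : ∀ z : ℍ, f z = h z) : Hol f := by
  refine hh.congr fun z hz => ?_
  rw [Function.comp_apply, ofComplex_apply_of_im_pos hz, hf]

lemma Hol.comp {f : ℍ → ℂ} (hf : Hol f) {φ : ℍ → ℍ} {h : ℂ → ℂ}
    (hh : DifferentiableOn ℂ h upperHalfPlaneSet) (hφ : ∀ z : ℍ, (φ z : ℂ) = h z) :
    Hol fun z => f (φ z) := by
  have hm : Set.MapsTo h upperHalfPlaneSet upperHalfPlaneSet := fun z hz => by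
    have := hφ ⟨z, hz⟩
    rw [show ((⟨z, hz⟩ : ℍ) : ℂ) = z from rfl] at this
    rw [← this]; exact (φ ⟨z, hz⟩).2
  refine Hol.of_coe (DifferentiableOn.comp hf hh hm) fun z => ?_
  rw [Function.comp_apply, Function.comp_apply, ← hφ, ofComplex_apply]

lemma Hol.add {f g : ℍ → ℂ} (hf : Hol f) (hg : Hol g) : Hol fun z => f z + g z :=
  DifferentiableOn.add hf hg

lemma Hol.sub {f g : ℍ → ℂ} (hf : Hol f) (hg : Hol g) : Hol fun z => f z - g z :=
  DifferentiableOn.sub hf hg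

lemma Hol.mul {f g : ℍ → ℂ} (hf : Hol f) (hg : Hol g) : Hol fun z => f z * g z :=
  DifferentiableOn.mul hf hg

lemma Hol.div {f g : ℍ → ℂ} (hf : Hol f) (hg : Hol g) (h0 : ∀ z, g z ≠ 0) :
    Hol fun z => f z / g z :=
  DifferentiableOn.div hf hg fun _ _ => h0 _

lemma Hol.pow {f : ℍ → ℂ} (hf : Hol f) (n : ℕ) : Hol fun z => f z ^ n :=
  DifferentiableOn.pow hf n

lemma Hol.zpow {f : ℍ → ℂ} (hf : Hol f) (h0 : ∀ z, f z ≠ 0) (n : ℤ) : Hol fun z => f z ^ n :=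
  DifferentiableOn.zpow hf (Or.inl fun _ _ => h0 _)

lemma Hol.const (c : ℂ) : Hol fun _ => c := differentiableOn_const c

lemma Hol.sum {ι : Type*} (s : Finset ι) {f : ι → ℍ → ℂ} (hf : ∀ i, Hol (f i)) :
    Hol fun z => ∑ i ∈ s, f i z :=
  (DifferentiableOn.fun_sum fun i _ => hf i :
    DifferentiableOn ℂ (fun z => ∑ i ∈ s, (f i ∘ ofComplex) z) upperHalfPlaneSet)

lemma Hol.mdiff {f : ℍ → ℂ} (hf : Hol f) : MDiff f := UpperHalfPlane.mdifferentiable_iff.mpr hf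

lemma hol_eta : Hol fun z => eta z :=
  Hol.of_coe (fun _ hz => (differentiableAt_eta_of_mem_upperHalfPlaneSet hz).differentiableWithinAt)
    fun _ => rfl

lemma hol_E2 : Hol EisensteinSeries.E2 :=
  UpperHalfPlane.mdifferentiable_iff.mp E2_mdifferentiable

/-- A bounded holomorphic function of weight two for the full modular group vanishes. -/
lemma eq_zero_of_weight_two {f : ℍ → ℂ} (hf : Hol f) (hT : ∀ z, f (T • z) = f z)
    (hS : ∀ z, f (S • z) = (z : ℂ) ^ 2 * f z) (hb : IsBoundedAtImInfty f) : f = 0 := by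
  have hS' : f ∣[(2 : ℤ)] S = f := by
    ext z
    rw [SlashInvariantForm.slash_S_apply, ← modular_S_smul, hS]
    have := z.ne_zero
    rw [zpow_neg]; field_simp
  have hT' : f ∣[(2 : ℤ)] T = f := by
    ext z
    rw [SL_slash_apply, hT, ModularGroup.denom_apply]
    simp [ModularGroup.T]
  let F : ModularForm 𝒮ℒ 2 :=
    { toFun := f
      slash_action_eq' := by
        rintro _ ⟨A, rfl⟩
        exact SlashInvariantForm.slash_action_generators_SL2Z hS' hT' A
      holo' := hf.mdiff
      bdd_at_cusps' := fun {c} hc => by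
        rw [Subgroup.IsArithmetic.isCusp_iff_isCusp_SL2Z] at hc
        rw [OnePoint.isBoundedAt_iff_forall_SL2Z hc]
        intro γ _
        rw [SlashInvariantForm.slash_action_generators_SL2Z hS' hT']
        exact hb }
  have h0 : F = 0 := rank_zero_iff_forall_zero.mp levelOne_weight_two_rank_zero F
  ext z
  exact DFunLike.congr_fun h0 z

lemma E2_eq_of_coe {w z : ℍ} {n : ℤ} (h : (w : ℂ) = z + n) :
    EisensteinSeries.E2 w = EisensteinSeries.E2 z := by
  have h1 := EisensteinSeries.hasSum_qExpansion_E2 (z := w)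
  have h2 := EisensteinSeries.hasSum_qExpansion_E2 (z := z)
  have : cexp (2 * Real.pi * Complex.I * w) = cexp (2 * Real.pi * Complex.I * z) := by
    rw [Complex.exp_eq_exp_iff_exists_int]; exact ⟨n, by rw [h]; ring⟩
  rw [this] at h1
  exact h1.unique h2

/-- The constant in the quasimodular transformation law of `E₂`. -/
def quasiConst : ℂ := 1 / (2 * riemannZeta 2) * (2 * Real.pi * Complex.I)

lemma E2_smul (γ : SL(2, ℤ)) (z : ℍ) :
    EisensteinSeries.E2 (γ • z) =
      denom γ z ^ 2 * EisensteinSeries.E2 z - quasiConst * γ 1 0 * denom γ z := by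
  have h := congrFun (EisensteinSeries.E2_slash_action γ) z
  rw [SL_slash_apply] at h
  simp only [Pi.sub_apply, Pi.smul_apply, EisensteinSeries.D2, smul_eq_mul] at h
  have hd := denom_ne_zero (γ : GL (Fin 2) ℝ) z
  have h2 : EisensteinSeries.E2 (γ • z) = denom γ z ^ 2 *
      (EisensteinSeries.E2 (γ • z) * denom γ z ^ (-2 : ℤ)) := by
    rw [show (-2 : ℤ) = -((2 : ℕ) : ℤ) by rfl, zpow_neg, zpow_natCast]; field_simp
  rw [h2, h, quasiConst]
  field_simp

lemma E2_S_smul (z : ℍ) :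
    EisensteinSeries.E2 (S • z) = (z : ℂ) ^ 2 * EisensteinSeries.E2 z - quasiConst * z := by
  rw [E2_smul, ModularGroup.denom_S]
  simp [ModularGroup.S]

/-! ### Conjugates of the weight 2 form and their transformation laws. -/

variable (t)

/-- The weight two Eisenstein series attached to the points of the projective line. -/
def eisCusp : Option (ZMod t) → ℍ → ℂ
  | none, z => -(t : ℂ) * eisTwo t z
  | some x, z => 1 / ((t : ℂ) - 1) *
      ((t : ℂ) * EisensteinSeries.E2 z - EisensteinSeries.E2 (affPoint t (lift24 t x) z))

/-- The conjugates of the Hauptmodul attached to the points of the projective line. -/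
def hauptCusp (p : Option (ZMod t)) (z : ℍ) : ℂ := (etaCusp t p z / eta z) ^ (24 / (t - 1))

/-- The conjugates of the weight two form attached to the points of the projective line. -/
def formCusp (m : ℤ) (k : ℤ → ℂ) (p : Option (ZMod t)) (z : ℍ) : ℂ :=
  eisCusp t p z * (hauptCusp t p z ^ (-m) +
    ∑ j ∈ Finset.Icc (1 : ℤ) (-m - 1), k j * hauptCusp t p z ^ j)

/-- The linear combinations with coefficients `D` of the conjugates of weight `3 / 2`, multiplied
by eta functions. -/
def combCusp (D : Option (ZMod t) → Option (ZMod t) → ℂ) (m : ℤ) (k : ℤ → ℂ)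
    (p : Option (ZMod t)) (z : ℍ) : ℂ :=
  etaCusp t p z * ∑ p', D p p' * (formCusp t m k p' z / etaCusp t p' z)

variable {t}

lemma coe_mulPoint_affPoint (a : ℤ) (z : ℍ) : (mulPoint t (affPoint t a z) : ℂ) = z + a := by
  rw [coe_mulPoint, coe_affPoint]
  exact mul_div_cancel₀ _ (natCast_ne_zero t)

lemma eisTwo_affPoint (x : ZMod t) (z : ℍ) :
    eisTwo t (affPoint t (lift24 t x) z) = eisCusp t (some x) z := by
  rw [eisTwo, E2_eq_of_coe (coe_mulPoint_affPoint _ z), eisCusp]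

lemma hauptmodul_affPoint (x : ZMod t) (z : ℍ) :
    hauptmodul t (affPoint t (lift24 t x) z) = hauptCusp t (some x) z := by
  have : eta (mulPoint t (affPoint t (lift24 t x) z) : ℂ) = eta z := by
    obtain ⟨l, hl⟩ := dvd_lift24 t x
    rw [coe_mulPoint_affPoint, hl, eta_add_int,
      show (((24 * l : ℤ) : ℂ) / 24) = (l : ℤ) by push_cast; ring, expo_int, one_mul]
  rw [hauptmodul, this, hauptCusp, etaCusp]

lemma formCusp_some (m : ℤ) (k : ℤ → ℂ) (x : ZMod t) (z : ℍ) :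
    formCusp t m k (some x) z = eisTwo t (affPoint t (lift24 t x) z) *
      hauptmodulPoly t m k (affPoint t (lift24 t x) z) := by
  rw [formCusp, hauptmodulPoly, eisTwo_affPoint, hauptmodul_affPoint]

lemma eisCusp_T (hc : t.Coprime 24) (p : Option (ZMod t)) (z : ℍ) :
    eisCusp t p (T • z) = eisCusp t (shiftEquiv t p) z := by
  have hT : EisensteinSeries.E2 (T • z) = EisensteinSeries.E2 z :=
    E2_eq_of_coe (n := 1) (by rw [coe_T_smul]; simp)
  rcases p with _ | x
  · have h : EisensteinSeries.E2 (mulPoint t (T • z)) = EisensteinSeries.E2 (mulPoint t z) :=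
      E2_eq_of_coe (n := t) (by rw [coe_mulPoint, coe_mulPoint, coe_T_smul]; push_cast; ring)
    rw [shiftEquiv_none, eisCusp, eisCusp, eisTwo, eisTwo, hT, h]
  · have hd : (t : ℤ) ∣ lift24 t x + 1 - lift24 t (x + 1) := by
      rw [← ZMod.intCast_zmod_eq_zero_iff_dvd]; push_cast; simp [coe_lift24 hc]
    obtain ⟨l, hl⟩ := hd
    have h : EisensteinSeries.E2 (affPoint t (lift24 t x) (T • z)) =
        EisensteinSeries.E2 (affPoint t (lift24 t (x + 1)) z) := by
      refine E2_eq_of_coe (n := l) ?_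
      rw [coe_affPoint, coe_affPoint, coe_T_smul,
        show lift24 t x = lift24 t (x + 1) - 1 + t * l by linarith]
      have := natCast_ne_zero t
      push_cast; field_simp; ring
    rw [shiftEquiv_some, eisCusp, eisCusp, hT, h]

/-- The quasimodular corrections of the two E₂ terms cancel; for x ≠ 0 this uses that the lower left
entry of the connecting matrix is t. -/
lemma eisCusp_S (hc : t.Coprime 24) (p : Option (ZMod t)) (z : ℍ) :
    eisCusp t p (S • z) = (z : ℂ) ^ 2 * eisCusp t (invEquiv t p) z := by
  have ht := natCast_ne_zero t
  rcases p with _ | x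
  · rw [invEquiv_none, eisCusp, eisCusp, eisTwo, coe_mulPoint_S, E2_S_smul, E2_S_smul, lift24_zero,
      coe_affPoint]
    push_cast
    field_simp
    ring
  · by_cases hx : x = 0
    · subst hx
      rw [invEquiv_zero, eisCusp, eisCusp, eisTwo, lift24_zero, affPoint_zero_S, E2_S_smul,
        E2_S_smul, coe_mulPoint]
      ring
    · obtain ⟨γ, h10, hγ⟩ := exists_smul_affPoint hc hx
      rw [invEquiv_some hx, eisCusp, eisCusp, (hγ z).1, E2_S_smul, E2_smul, (hγ z).2, h10]
      push_cast
      ring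

lemma hauptCusp_T (hc : t.Coprime 24) (ht : t - 1 ∣ 24) (p : Option (ZMod t)) (z : ℍ) :
    hauptCusp t p (T • z) = hauptCusp t (shiftEquiv t p) z := by
  have h1 : eta ((T • z : ℍ) : ℂ) = expo (1 / 24) * eta z := by
    have := eta_add_int z 1
    rw [coe_T_smul]
    simpa using this
  obtain ⟨l, hl⟩ := ht
  have h1t := (Fact.out : t.Prime).one_lt
  have hl' : 24 / (t - 1) = l := by rw [hl]; exact Nat.mul_div_cancel_left _ (by omega)
  have hlC : (24 : ℂ) = ((t : ℂ) - 1) * l := by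
    have : ((24 : ℕ) : ℂ) = (((t - 1 : ℕ) : ℕ) : ℂ) * l := by rw [hl]; push_cast; rfl
    rw [Nat.cast_sub h1t.le] at this
    exact_mod_cast this
  have h2 : (expo ((t : ℂ) / 24) / expo (1 / 24)) ^ (24 / (t - 1)) = 1 := by
    rw [← expo_sub, expo_pow, hl', show (l : ℂ) * ((t : ℂ) / 24 - 1 / 24) = ((1 : ℤ) : ℂ) by
      push_cast; linear_combination (-1 / 24 : ℂ) * hlC, expo_int]
  rw [hauptCusp, hauptCusp, etaCusp_T hc, h1, mul_div_mul_comm, mul_pow, h2, one_mul]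

lemma hauptCusp_S {ν : Option (ZMod t) → ℂ}
    (hν : ∀ p z, etaCusp t p (S • z) = ν p * etaFactor z * etaCusp t (invEquiv t p) z)
    (hr : ∀ p, ν p ^ (24 / (t - 1)) = 1) (p : Option (ZMod t)) (z : ℍ) :
    hauptCusp t p (S • z) = hauptCusp t (invEquiv t p) z := by
  rw [hauptCusp, hauptCusp, hν, eta_S_smul, mul_assoc, mul_div_assoc,
    mul_div_mul_left _ _ (etaFactor_ne_zero z), mul_pow, hr, one_mul]

lemma formCusp_S {ν : Option (ZMod t) → ℂ}
    (hν : ∀ p z, etaCusp t p (S • z) = ν p * etaFactor z * etaCusp t (invEquiv t p) z)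
    (hc : t.Coprime 24) (hr : ∀ p, ν p ^ (24 / (t - 1)) = 1) (m : ℤ) (k : ℤ → ℂ)
    (p : Option (ZMod t)) (z : ℍ) :
    formCusp t m k p (S • z) = (z : ℂ) ^ 2 * formCusp t m k (invEquiv t p) z := by
  simp only [formCusp, eisCusp_S hc, hauptCusp_S hν hr, mul_assoc]

/-- The condition `hD` is intertwining twisted by ν: the outer eta function contributes ν p, the
inner one 1/ν p', and the weight 1/2 factors cancel. -/
lemma combCusp_S {ν : Option (ZMod t) → ℂ}
    (hν : ∀ p z, etaCusp t p (S • z) = ν p * etaFactor z * etaCusp t (invEquiv t p) z)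
    (hc : t.Coprime 24) (hr : ∀ p, ν p ^ (24 / (t - 1)) = 1)
    {D : Option (ZMod t) → Option (ZMod t) → ℂ}
    (hD : ∀ p p', ν p * D p p' = ν p' * D (invEquiv t p) (invEquiv t p')) (m : ℤ) (k : ℤ → ℂ)
    (p : Option (ZMod t)) (z : ℍ) :
    combCusp t D m k p (S • z) = (z : ℂ) ^ 2 * combCusp t D m k (invEquiv t p) z := by
  have hν0 (p) : ν p ≠ 0 := fun h0 => etaCusp_ne_zero p (S • z) (by rw [hν, h0]; ring)
  have hJ := etaFactor_ne_zero z
  rw [combCusp, combCusp, hν, ← Equiv.sum_comp (invEquiv t)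
      (fun p' => D (invEquiv t p) p' * (formCusp t m k p' z / etaCusp t p' z)),
    Finset.mul_sum, Finset.mul_sum, Finset.mul_sum]
  refine Finset.sum_congr rfl fun p' _ => ?_
  rw [formCusp_S hν hc hr, hν]
  have h1 := hν0 p'
  have h2 := etaCusp_ne_zero (invEquiv t p') z
  field_simp
  linear_combination (z ^ 2 * etaCusp t (invEquiv t p) z *
    formCusp t m k (invEquiv t p') z) * hD p p'

lemma formCusp_T (hc : t.Coprime 24) (ht : t - 1 ∣ 24) (m : ℤ) (k : ℤ → ℂ)
    (p : Option (ZMod t)) (z : ℍ) :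
    formCusp t m k p (T • z) = formCusp t m k (shiftEquiv t p) z := by
  simp only [formCusp, eisCusp_T hc, hauptCusp_T hc ht]

lemma combCusp_T (hc : t.Coprime 24) (ht : t - 1 ∣ 24)
    {D : Option (ZMod t) → Option (ZMod t) → ℂ}
    (hD : ∀ p p', D p p' = D (shiftEquiv t p) (shiftEquiv t p')) (m : ℤ) (k : ℤ → ℂ)
    (p : Option (ZMod t)) (z : ℍ) :
    combCusp t D m k p (T • z) = combCusp t D m k (shiftEquiv t p) z := by
  rw [combCusp, combCusp, etaCusp_T hc, ← Equiv.sum_comp (shiftEquiv t)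
      (fun p' => D (shiftEquiv t p) p' * (formCusp t m k p' z / etaCusp t p' z)),
    Finset.mul_sum, Finset.mul_sum]
  refine Finset.sum_congr rfl fun p' _ => ?_
  rw [formCusp_T hc ht, etaCusp_T hc, hD p p']
  have := expo_ne_zero ((t : ℂ) / 24)
  field_simp

lemma hol_etaCusp (p : Option (ZMod t)) : Hol (etaCusp t p) := by
  rcases p with _ | x
  · exact (Hol.const _).mul (hol_eta.comp (φ := mulPoint t) (h := fun z => t * z) (by fun_prop)
      fun z => rfl)
  · exact hol_eta.comp (φ := affPoint t (lift24 t x)) (h := fun z => (z + lift24 t x) / t)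
      (by fun_prop) fun z => rfl

lemma hol_hauptCusp (p : Option (ZMod t)) : Hol (hauptCusp t p) :=
  ((hol_etaCusp p).div hol_eta eta_coe_ne_zero).pow _

lemma hauptCusp_ne_zero (p : Option (ZMod t)) (z : ℍ) : hauptCusp t p z ≠ 0 :=
  pow_ne_zero _ (div_ne_zero (etaCusp_ne_zero p z) (eta_coe_ne_zero z))

lemma hol_eisCusp (p : Option (ZMod t)) : Hol (eisCusp t p) := by
  rcases p with _ | x
  · exact (Hol.const _).mul ((Hol.const _).mul (((Hol.const _).mul (hol_E2.comp (φ := mulPoint t)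
      (h := fun z => t * z) (by fun_prop) fun z => rfl)).sub hol_E2))
  · exact (Hol.const _).mul (((Hol.const _).mul hol_E2).sub (hol_E2.comp
      (φ := affPoint t (lift24 t x)) (h := fun z => (z + lift24 t x) / t)
      (by fun_prop) fun z => rfl))

lemma hol_formCusp (m : ℤ) (k : ℤ → ℂ) (p : Option (ZMod t)) : Hol (formCusp t m k p) :=
  (hol_eisCusp p).mul (((hol_hauptCusp p).zpow (hauptCusp_ne_zero p) _).add
    (Hol.sum _ fun _ => (Hol.const _).mul ((hol_hauptCusp p).zpow (hauptCusp_ne_zero p) _)))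

lemma hol_combCusp (D : Option (ZMod t) → Option (ZMod t) → ℂ) (m : ℤ) (k : ℤ → ℂ)
    (p : Option (ZMod t)) : Hol (combCusp t D m k p) :=
  (hol_etaCusp p).mul (Hol.sum _ fun p' => (Hol.const _).mul
    ((hol_formCusp m k p').div (hol_etaCusp p') (etaCusp_ne_zero p')))

/-! ### Expansions in powers q^(n - 1/24). -/

lemma qShift_eq (n : ℤ) (z : ℍ) : qShift n z = expo (((n : ℂ) - 1 / 24) * z) := by
  rw [qShift, expo]; ring_nf

lemma tendsto_im_atImInfty : Tendsto UpperHalfPlane.im atImInfty atTop := tendsto_comap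

lemma tendsto_expo_mul {a : ℝ} (ha : 0 < a) :
    Tendsto (fun z : ℍ => expo ((a : ℂ) * z)) atImInfty (𝓝 0) := by
  rw [tendsto_zero_iff_norm_tendsto_zero]
  have h : Tendsto (fun z : ℍ => Real.exp (-(2 * Real.pi * a * z.im))) atImInfty (𝓝 0) :=
    Real.tendsto_exp_neg_atTop_nhds_zero.comp
      (tendsto_im_atImInfty.const_mul_atTop (by positivity))
  refine h.congr fun z => ?_
  rw [norm_expo, Complex.im_ofReal_mul, UpperHalfPlane.coe_im]
  congr 1; ring

/-- Dominated convergence: for Im z ≥ 1 the terms are bounded by their absolute values at z = i,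
where the series converges absolutely. -/
lemma HasShiftedExpansion.tendsto {F : ℍ → ℂ} {m : ℤ} {c : ℤ → ℂ}
    (h : HasShiftedExpansion F m c) {N : ℤ} (hN : m ≤ N) (h0 : ∀ n, m ≤ n → n < N → c n = 0) :
    Tendsto (fun z => F z / qShift N z) atImInfty (𝓝 (c N)) := by
  have hq (n : ℤ) (z : ℍ) : qShift n z / qShift N z = expo (((n - N : ℝ) : ℂ) * z) := by
    rw [qShift_eq, qShift_eq, ← expo_sub]; congr 1; push_cast; ring
  have hs (z : ℍ) : HasSum (fun n : {n : ℤ // m ≤ n} => c n * expo ((((n : ℤ) - N : ℝ) : ℂ) * z))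
      (F z / qShift N z) := by
    refine ((h z).div_const (qShift N z)).congr_fun fun n => ?_
    rw [← hq, mul_div_assoc]
  have hlim : ∑' n : {n : ℤ // m ≤ n}, (if n = ⟨N, hN⟩ then c N else 0) = c N := tsum_ite_eq _ _
  rw [← hlim]
  refine (tendsto_tsum_of_dominated_convergence (hs UpperHalfPlane.I).summable.norm
    (f := fun (z : ℍ) (n : {n : ℤ // m ≤ n}) => c n * expo ((((n : ℤ) - N : ℝ) : ℂ) * z))
    ?_ ?_).congr fun z => (hs z).tsum_eq
  · rintro ⟨n, hn⟩
    dsimp only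
    rcases lt_trichotomy n N with hlt | rfl | hlt
    · rw [h0 n hn hlt, if_neg (by simpa using hlt.ne)]; simp
    · simp [expo_zero]
    · rw [if_neg (by simpa using hlt.ne')]
      simpa using (tendsto_expo_mul (a := n - N) (by
        rw [sub_pos]; exact_mod_cast hlt)).const_mul (c n)
  · filter_upwards [tendsto_im_atImInfty.eventually_ge_atTop 1] with z hz
    rintro ⟨n, hn⟩
    dsimp only
    rcases lt_or_ge n N with hlt | hge
    · rw [h0 n hn hlt]; simp
    · rw [norm_mul, norm_mul, norm_expo, norm_expo]
      have h1 : (0 : ℝ) ≤ n - N := by rw [sub_nonneg]; exact_mod_cast hge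
      gcongr ‖c n‖ * Real.exp ?_
      rw [Complex.im_ofReal_mul, Complex.im_ofReal_mul, UpperHalfPlane.coe_im,
        UpperHalfPlane.coe_im, UpperHalfPlane.I_im]
      have := mul_le_mul_of_nonneg_left hz (mul_nonneg Real.two_pi_pos.le h1)
      linarith

lemma HasShiftedExpansion.eq_zero {F : ℍ → ℂ} {m : ℤ} {c : ℤ → ℂ}
    (h : HasShiftedExpansion F m c) (hF : ∀ᶠ z in atImInfty, F z = 0) (n : ℤ) (hn : m ≤ n) :
    c n = 0 := by
  obtain ⟨d, rfl⟩ := Int.le.dest hn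
  induction d using Nat.strong_induction_on with
  | _ d ih =>
    refine tendsto_nhds_unique (h.tendsto hn fun i hi hlt => ?_)
      (tendsto_const_nhds.congr' (hF.mono fun z hz => ?_))
    · obtain ⟨e, rfl⟩ := Int.le.dest hi
      exact ih e (by omega) hi
    · simp only [hz, zero_div]

lemma HasShiftedExpansion.comp {F : ℍ → ℂ} {m : ℤ} {c : ℤ → ℂ}
    (h : HasShiftedExpansion F m c) {φ : ℍ → ℍ} {s : ℂ} (hφ : ∀ z, (φ z : ℂ) = z + s) :
    HasShiftedExpansion (fun z => F (φ z)) m fun n => c n * expo (((n : ℂ) - 1 / 24) * s) := by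
  intro z
  refine (h (φ z)).congr_fun fun n => ?_
  rw [qShift_eq, qShift_eq, hφ, mul_add, expo_add]; ring

lemma HasShiftedExpansion.const_mul {F : ℍ → ℂ} {m : ℤ} {c : ℤ → ℂ}
    (h : HasShiftedExpansion F m c) (a : ℂ) :
    HasShiftedExpansion (fun z => a * F z) m fun n => a * c n := by
  intro z
  refine ((h z).mul_left a).congr_fun fun n => ?_
  rw [mul_assoc]

lemma HasShiftedExpansion.sub {F G : ℍ → ℂ} {m : ℤ} {c d : ℤ → ℂ}
    (h : HasShiftedExpansion F m c) (h' : HasShiftedExpansion G m d) :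
    HasShiftedExpansion (fun z => F z - G z) m fun n => c n - d n := by
  intro z
  refine ((h z).sub (h' z)).congr_fun fun n => ?_
  rw [sub_mul]

lemma HasShiftedExpansion.sum {ι : Type*} (s : Finset ι) {F : ι → ℍ → ℂ} {m : ℤ}
    {c : ι → ℤ → ℂ} (h : ∀ i, HasShiftedExpansion (F i) m (c i)) :
    HasShiftedExpansion (fun z => ∑ i ∈ s, F i z) m fun n => ∑ i ∈ s, c i n := by
  intro z
  refine (hasSum_sum fun i _ => h i z).congr_fun fun n => ?_
  rw [Finset.sum_mul]

/-! ### Gauss sums of the quadratic character. -/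

lemma quadChar_ne_one (h2 : t ≠ 2) : quadChar t ≠ 1 := by
  rw [quadChar, MulChar.ringHomComp_ne_one_iff (RingHom.injective_int _)]
  exact quadraticChar_ne_one (by rwa [ZMod.ringChar_zmod_n])

lemma quadChar_mul_self {x : ZMod t} (hx : x ≠ 0) : quadChar t x * quadChar t x = 1 := by
  have := quadraticChar_sq_one hx
  rw [sq] at this
  rw [quadChar_apply]; exact_mod_cast this

lemma quadChar_inv (x : ZMod t) : quadChar t x⁻¹ = quadChar t x := by
  by_cases hx : x = 0
  · simp [hx]
  · have h1 := quadChar_mul_self hx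
    have h2 : quadChar t x⁻¹ * quadChar t x = 1 := by rw [← map_mul, inv_mul_cancel₀ hx, map_one]
    have h3 : quadChar t x ≠ 0 := by rintro h; simp [h] at h1
    exact mul_right_cancel₀ h3 (h2.trans h1.symm)

/-- The Gauss sum of the quadratic character modulo `t`. -/
def quadGauss (t : ℕ) [Fact t.Prime] : ℂ := gaussSum (quadChar t) (ZMod.stdAddChar (N := t))

lemma quadGauss_ne_zero (h2 : t ≠ 2) : quadGauss t ≠ 0 :=
  gaussSum_ne_zero_of_nontrivial (by simpa using natCast_ne_zero t) (quadChar_ne_one h2)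
    (ZMod.isPrimitive_stdAddChar t)

lemma sum_quadChar_mul (h2 : t ≠ 2) (a : ZMod t) :
    ∑ y, quadChar t y * ZMod.stdAddChar (a * y) = quadChar t a * quadGauss t := by
  by_cases ha : a = 0
  · rw [ha, MulChar.map_zero]
    simp [MulChar.sum_eq_zero_of_ne_one (quadChar_ne_one h2)]
  · have h := gaussSum_mulShift (quadChar t) (ZMod.stdAddChar (N := t)) (Units.mk0 a ha)
    have h1 := quadChar_mul_self ha
    rw [Units.val_mk0] at h
    rw [quadGauss, ← h, ← mul_assoc, h1, one_mul]
    rfl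

lemma sum_stdAddChar_mul {a : ZMod t} (ha : a ≠ 0) :
    ∑ y : ZMod t, ZMod.stdAddChar (a * y) = (0 : ℂ) := by
  have := AddChar.sum_mulShift a (ZMod.isPrimitive_stdAddChar t)
  simpa [mul_comm, ha] using this

/-- Divisibility of the lift by 24 clears the denominator of n - 1/24, so translation acts through
an additive character modulo t. -/
lemma expo_lift24 (n : ℤ) (y : ZMod t) :
    expo (((n : ℂ) - 1 / 24) * ((lift24 t y : ℂ) / t)) =
      ZMod.stdAddChar (((24 * n - 1 : ℤ) : ZMod t) * (24 : ZMod t)⁻¹ * y) := by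
  have h : ((24 * n - 1 : ℤ) : ZMod t) * (24 : ZMod t)⁻¹ * y =
      (((24 * n - 1) * (((24 : ZMod t)⁻¹ * y).val : ℤ) : ℤ) : ZMod t) := by
    push_cast
    rw [ZMod.natCast_zmod_val, mul_assoc]
  rw [h, ZMod.stdAddChar_coe, expo, lift24]
  congr 1
  push_cast
  ring

/-! ### Behaviour of the conjugates at infinity. -/

lemma tendsto_mulPoint : Tendsto (mulPoint t) atImInfty atImInfty := by
  refine tendsto_comap_iff.mpr ?_
  have ht : (0 : ℝ) < (t : ℝ) := Nat.cast_pos.mpr (NeZero.pos t)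
  refine (tendsto_im_atImInfty.const_mul_atTop ht).congr fun z => ?_
  change _ = ((t : ℂ) * (z : ℂ)).im
  simp

lemma tendsto_affPoint (a : ℤ) : Tendsto (affPoint t a) atImInfty atImInfty := by
  refine tendsto_comap_iff.mpr ?_
  have ht : (0 : ℝ) < (t : ℝ) := Nat.cast_pos.mpr (NeZero.pos t)
  refine (tendsto_im_atImInfty.atTop_div_const ht).congr fun z => ?_
  change _ = (((z : ℂ) + a) / t).im
  simp [Complex.div_natCast_im]

lemma tendsto_eta_mulPoint :
    Tendsto (fun z : ℍ => eta (mulPoint t z) / expo ((t : ℂ) / 24 * z)) atImInfty (𝓝 1) := by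
  refine (tendsto_eta_div_expo.comp (tendsto_mulPoint (t := t))).congr fun z => ?_
  simp only [Function.comp_apply, coe_mulPoint]
  ring_nf

lemma expo_exponent (ht : t - 1 ∣ 24) (z : ℂ) :
    (expo ((t : ℂ) / 24 * z) / expo (z / 24)) ^ (24 / (t - 1)) = expo z := by
  obtain ⟨l, hl⟩ := ht
  have h1t := (Fact.out : t.Prime).one_lt
  have hl' : 24 / (t - 1) = l := by rw [hl]; exact Nat.mul_div_cancel_left _ (by omega)
  have hlC : (24 : ℂ) = ((t : ℂ) - 1) * l := by
    have : ((24 : ℕ) : ℂ) = (((t - 1 : ℕ) : ℕ) : ℂ) * l := by rw [hl]; push_cast; rfl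
    rw [Nat.cast_sub h1t.le] at this
    exact_mod_cast this
  rw [← expo_sub, expo_pow, hl']
  congr 1
  linear_combination (-z / 24) * hlC

lemma tendsto_hauptCusp_none (ht : t - 1 ∣ 24) :
    Tendsto (fun z => hauptCusp t none z / expo z) atImInfty
      (𝓝 ((Real.sqrt t : ℂ) ^ (24 / (t - 1)))) := by
  have h := (((tendsto_const_nhds (x := (Real.sqrt t : ℂ))).mul
    (tendsto_eta_mulPoint (t := t))).div tendsto_eta_div_expo one_ne_zero).pow (24 / (t - 1))
  rw [mul_one, div_one] at h
  refine h.congr fun z => ?_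
  rw [hauptCusp, ← expo_exponent ht (z : ℂ), etaCusp, ← div_pow]
  congr 1
  have := expo_ne_zero ((t : ℂ) / 24 * z)
  have := expo_ne_zero ((z : ℂ) / 24)
  have := eta_coe_ne_zero z
  simp only [Pi.div_apply]
  field_simp

lemma tendsto_hauptmodul (ht : t - 1 ∣ 24) :
    Tendsto (fun z => hauptmodul t z * expo z) atImInfty (𝓝 1) := by
  have h := (tendsto_eta_div_expo.div (tendsto_eta_mulPoint (t := t)) one_ne_zero).pow
    (24 / (t - 1))
  rw [div_one, one_pow] at h
  refine h.congr fun z => ?_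
  rw [hauptmodul, ← expo_exponent ht (z : ℂ), ← mul_pow]
  congr 1
  have := expo_ne_zero ((t : ℂ) / 24 * z)
  have := expo_ne_zero ((z : ℂ) / 24)
  have := eta_coe_ne_zero (mulPoint t z)
  simp only [Pi.div_apply]
  field_simp

lemma tendsto_expo : Tendsto (fun z : ℍ => expo z) atImInfty (𝓝 0) := by
  simpa using tendsto_expo_mul one_pos

lemma tendsto_hauptCusp_none_zero (ht : t - 1 ∣ 24) :
    Tendsto (hauptCusp t none) atImInfty (𝓝 0) := by
  have h := (tendsto_hauptCusp_none ht).mul tendsto_expo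
  rw [mul_zero] at h
  exact h.congr fun z => div_mul_cancel₀ _ (expo_ne_zero _)

lemma tendsto_etaCusp_none_div : Tendsto (fun z => etaCusp t none z / expo ((t : ℂ) / 24 * z))
    atImInfty (𝓝 (Real.sqrt t : ℂ)) := by
  have h := (tendsto_eta_mulPoint (t := t)).const_mul (Real.sqrt t : ℂ)
  rw [mul_one] at h
  exact h.congr fun z => by rw [etaCusp, mul_div_assoc]

lemma tendsto_etaCusp_none : Tendsto (etaCusp t none) atImInfty (𝓝 0) := by
  have h := (tendsto_etaCusp_none_div (t := t)).mul (tendsto_expo_mul (a := t / 24)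
    (by have := (Fact.out : t.Prime).pos; positivity))
  rw [mul_zero] at h
  refine h.congr fun z => ?_
  push_cast
  exact div_mul_cancel₀ _ (expo_ne_zero _)

/-- The quotient has size q^(1 - t/24), which is where t < 24 matters. -/
lemma tendsto_hauptCusp_div_etaCusp (ht : t - 1 ∣ 24) (h24 : t < 24) :
    Tendsto (fun z => hauptCusp t none z / etaCusp t none z) atImInfty (𝓝 0) := by
  have h := ((tendsto_hauptCusp_none ht).div (tendsto_etaCusp_none_div (t := t))
    sqrt_natCast_ne_zero).mul (tendsto_expo_mul (a := 1 - t / 24) (by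
      have : (t : ℝ) < 24 := by exact_mod_cast h24
      linarith))
  rw [mul_zero] at h
  refine h.congr fun z => ?_
  have h1 := expo_ne_zero ((t : ℂ) / 24 * z)
  have h2 := expo_ne_zero (z : ℂ)
  have h3 := etaCusp_ne_zero none z (t := t)
  rw [show (((1 - t / 24 : ℝ) : ℂ) * z) = z - (t : ℂ) / 24 * z by push_cast; ring, expo_sub]
  simp only [Pi.div_apply]
  generalize expo ((t : ℂ) / 24 * z) = a at h1
  field_simp

lemma isBoundedAtImInfty_eisCusp_none : IsBoundedAtImInfty (eisCusp t none) := by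
  have h1 := EisensteinSeries.isBoundedAtImInfty_E2
  have h2 : IsBoundedAtImInfty fun z => EisensteinSeries.E2 (mulPoint t z) :=
    h1.comp_tendsto tendsto_mulPoint
  exact (((h2.const_mul_left (t : ℂ)).sub h1).const_mul_left _).const_mul_left _

/-- The conjugate of weight `3 / 2` at the second cusp vanishes at infinity. -/
lemma tendsto_formCusp_none (ht : t - 1 ∣ 24) (h24 : t < 24) {m : ℤ} (hm : m < 0) (k : ℤ → ℂ) :
    Tendsto (fun z => formCusp t m k none z / etaCusp t none z) atImInfty (𝓝 0) := by
  have hp (j : ℤ) (hj : 1 ≤ j) :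
      Tendsto (fun z => hauptCusp t none z ^ j / etaCusp t none z) atImInfty (𝓝 0) := by
    obtain ⟨i, rfl⟩ := Int.le.dest hj
    have h := ((tendsto_hauptCusp_none_zero ht).pow i).mul (tendsto_hauptCusp_div_etaCusp ht h24)
    rw [mul_zero] at h
    refine h.congr fun z => ?_
    rw [zpow_add₀ (hauptCusp_ne_zero none z), zpow_one, zpow_natCast]
    ring
  have h2 : Tendsto (fun z => hauptCusp t none z ^ (-m) / etaCusp t none z +
      ∑ j ∈ Finset.Icc (1 : ℤ) (-m - 1), k j * (hauptCusp t none z ^ j / etaCusp t none z))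
      atImInfty (𝓝 (0 + ∑ j ∈ Finset.Icc (1 : ℤ) (-m - 1), k j * 0)) :=
    (hp (-m) (by omega)).add (tendsto_finsetSum _ fun j hj =>
      (hp j (Finset.mem_Icc.mp hj).1).const_mul (k j))
  simp only [mul_zero, Finset.sum_const_zero, add_zero] at h2
  have h1 : eisCusp t none =O[atImInfty] fun _ => (1 : ℝ) := isBoundedAtImInfty_eisCusp_none
  have h4 := (Asymptotics.isLittleO_one_iff ℝ).mp
    ((h1.mul_isLittleO ((Asymptotics.isLittleO_one_iff ℝ).mpr h2)).congr_right
      fun z => mul_one (1 : ℝ))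
  refine h4.congr fun z => ?_
  rw [formCusp, mul_div_assoc, add_div, Finset.sum_div]
  simp only [mul_div_assoc]

/-! ### The intertwining matrix. -/

/-- The conference matrix of Paley type on the projective line over `ℤ / t`. -/
def conf (κ : ℂ) : Option (ZMod t) → Option (ZMod t) → ℂ
  | none, none => 0
  | none, some _ => κ
  | some _, none => κ
  | some x, some y => quadChar t (x - y)

/-- The matrix `1 - l C`, where `C` is the conference matrix. -/
def projMatrix (κ l : ℂ) (p p' : Option (ZMod t)) : ℂ := (if p = p' then 1 else 0) - l * conf κ p p'

lemma projMatrix_shift (κ l : ℂ) (p p' : Option (ZMod t)) :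
    projMatrix κ l p p' = projMatrix κ l (shiftEquiv t p) (shiftEquiv t p') := by
  simp only [projMatrix, (shiftEquiv t).apply_eq_iff_eq]
  rcases p with _ | x <;> rcases p' with _ | y <;> simp [conf]

/-- The core is χ(-1/x + 1/y) = χ(x - y)χ(x)χ(y); the entries κ at ∞ are compatible with it because
κ² = χ(-1). -/
lemma conf_inv {ν : Option (ZMod t) → ℂ} {κ : ℂ} (hn : ν none = 1) (h0 : ν (some 0) = 1)
    (hν : ∀ x, x ≠ 0 → ν (some x) = κ * quadChar t x) (hκ : κ ^ 2 = quadChar t (-1))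
    (p p' : Option (ZMod t)) :
    ν p * conf κ p p' = ν p' * conf κ (invEquiv t p) (invEquiv t p') := by
  have hneg (x : ZMod t) : quadChar t (-x) = quadChar t (-1) * quadChar t x := by
    rw [← map_mul, neg_one_mul]
  have hz : quadChar t 0 = 0 := MulChar.map_zero _
  rcases p with _ | x <;> rcases p' with _ | y
  · simp [conf, hn, hz]
  · by_cases hy : y = 0
    · subst hy; simp [conf, hn, h0]
    · have := quadChar_mul_self hy
      rw [invEquiv_some hy, hν y hy, invEquiv_none]
      simp only [conf, hn, zero_sub, neg_neg, quadChar_inv]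
      linear_combination (-κ) * this
  · by_cases hx : x = 0
    · subst hx; simp [conf, hn, h0]
    · have := quadChar_mul_self hx
      rw [invEquiv_some hx, hν x hx, invEquiv_none]
      simp only [conf, hn, sub_zero, hneg x⁻¹, quadChar_inv]
      linear_combination quadChar t x * hκ
  · by_cases hx : x = 0
    · by_cases hy : y = 0
      · subst hx; subst hy; simp [conf, hz]
      · subst hx
        rw [invEquiv_some hy, hν y hy, invEquiv_zero]
        simp only [conf, h0, zero_sub, hneg y]
        linear_combination (-quadChar t y) * hκ
    · by_cases hy : y = 0
      · subst hy
        have := quadChar_mul_self hx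
        rw [invEquiv_some hx, hν x hx, invEquiv_zero]
        simp only [conf, h0, sub_zero]
        linear_combination κ * this
      · have hyy := quadChar_mul_self hy
        rw [invEquiv_some hy, invEquiv_some hx, hν x hx, hν y hy]
        simp only [conf]
        rw [show -x⁻¹ - -y⁻¹ = (x - y) * (x⁻¹ * y⁻¹) by field_simp; ring, map_mul, map_mul,
          quadChar_inv, quadChar_inv]
        linear_combination (-κ * quadChar t (x - y) * quadChar t x) * hyy

lemma projMatrix_inv {ν : Option (ZMod t) → ℂ} {κ : ℂ} (l : ℂ) (hn : ν none = 1)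
    (h0 : ν (some 0) = 1) (hν : ∀ x, x ≠ 0 → ν (some x) = κ * quadChar t x)
    (hκ : κ ^ 2 = quadChar t (-1)) (p p' : Option (ZMod t)) :
    ν p * projMatrix κ l p p' = ν p' * projMatrix κ l (invEquiv t p) (invEquiv t p') := by
  have h := conf_inv hn h0 hν hκ p p'
  simp only [projMatrix, (invEquiv t).apply_eq_iff_eq]
  split_ifs with hp
  · subst hp; linear_combination (-l) * h
  · linear_combination (-l) * h

/-! ### Vanishing of permuted families of weight 2. -/

/-- A family of functions permuted by translations is determined at the finite points of the
projective line by its value at `0`. -/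
lemma apply_some_eq {A : Option (ZMod t) → ℍ → ℂ}
    (hA : ∀ p z, A p (T • z) = A (shiftEquiv t p) z) (x : ZMod t) (z : ℍ) :
    A (some x) z = A (some 0) (mulPoint t (affPoint t x.val z)) := by
  have h (n : ℕ) (y : ZMod t) :
      A (some y) (mulPoint t (affPoint t n z)) = A (some (y + n)) z := by
    induction n generalizing y with
    | zero =>
      congr 1
      · simp
      · ext1; rw [coe_mulPoint_affPoint]; simp
    | succ n ih =>
      have : mulPoint t (affPoint t (n + 1 : ℕ) z) = T • mulPoint t (affPoint t n z) := by
        ext1; rw [coe_T_smul, coe_mulPoint_affPoint, coe_mulPoint_affPoint]; push_cast; ring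
      rw [this, hA, shiftEquiv_some, ih]
      push_cast
      rw [add_assoc, add_comm 1]
  have := h x.val 0
  rw [zero_add, ZMod.natCast_zmod_val] at this
  exact this.symm

lemma hauptCusp_zero_mulPoint (w : ℍ) :
    hauptCusp t (some 0) (mulPoint t w) = hauptmodul t w := by
  rw [← hauptmodul_affPoint, lift24_zero]
  congr 1
  ext1
  rw [coe_affPoint, coe_mulPoint]
  have := natCast_ne_zero t
  simp; field_simp

lemma etaCusp_zero_mulPoint (w : ℍ) : etaCusp t (some 0) (mulPoint t w) = eta w := by
  rw [etaCusp, coe_affPoint, lift24_zero, coe_mulPoint]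
  have := natCast_ne_zero t
  congr 1; simp; field_simp

/-- A family of holomorphic functions of weight two permuted by the modular group, whose member at
the cusp `0` is bounded, and whose member at infinity stays small after multiplication by
powers of the Hauptmodul, vanishes near infinity. -/
lemma eventually_eq_zero_of_permuted (hc : t.Coprime 24) (ht : t - 1 ∣ 24)
    (hγ : ∀ p z, hauptCusp t p (S • z) = hauptCusp t (invEquiv t p) z)
    {A : Option (ZMod t) → ℍ → ℂ} (hA : ∀ p, Hol (A p))
    (hT : ∀ p z, A p (T • z) = A (shiftEquiv t p) z)
    (hS : ∀ p z, A p (S • z) = (z : ℂ) ^ 2 * A (invEquiv t p) z)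
    (hb : IsBoundedAtImInfty fun w => A (some 0) (mulPoint t w))
    (h0 : Tendsto (A none) atImInfty (𝓝 0)) :
    ∀ᶠ w in atImInfty, A (some 0) (mulPoint t w) = 0 := by
  set H : ℍ → ℂ := fun w => A (some 0) (mulPoint t w) with hH
  have hHhol : Hol H := (hA _).comp (φ := mulPoint t) (h := fun z => t * z) (by fun_prop)
    fun z => rfl
  have hper : Function.Periodic (H ∘ ofComplex) (1 : ℝ) := by
    intro z
    by_cases hz : 0 < z.im
    · have hz1 : 0 < (z + (1 : ℝ)).im := by simpa using hz
      rw [Function.comp_apply, Function.comp_apply, ofComplex_apply_of_im_pos hz,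
        ofComplex_apply_of_im_pos hz1, hH]
      have h2 (z : ℍ) (n : ℕ) (y : ZMod t) : A (some y) (T ^ n • z) = A (some (y + n)) z := by
        induction n generalizing y with
        | zero => simp
        | succ n ih =>
          rw [pow_succ', mul_smul, hT, shiftEquiv_some, ih]
          push_cast
          rw [add_assoc, add_comm 1]
      have h3 : mulPoint t ⟨z + (1 : ℝ), hz1⟩ = T ^ t • mulPoint t ⟨z, hz⟩ := by
        ext1
        have := modular_T_zpow_smul (mulPoint t ⟨z, hz⟩) t
        rw [zpow_natCast] at this
        rw [this, UpperHalfPlane.coe_vadd, coe_mulPoint, coe_mulPoint]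
        push_cast
        ring
      dsimp only
      rw [h3, h2]
      simp
    -- Off the upper half-plane `ofComplex` takes a constant default value, so periodicity is
    -- trivial there.
    · have hz1 : (z + (1 : ℝ)).im ≤ 0 := by simpa using hz
      rw [Function.comp_apply, Function.comp_apply, ofComplex_apply_of_im_nonpos (not_lt.mp hz),
        ofComplex_apply_of_im_nonpos hz1]
  have han := analyticAt_cuspFunction_zero one_pos hper hHhol.mdiff hb
  have hq : Tendsto (fun w : ℍ => Function.Periodic.qParam 1 (w : ℂ)) atImInfty (𝓝 0) :=
    qParam_tendsto_atImInfty one_pos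
  have hHq (w : ℍ) : cuspFunction 1 H (Function.Periodic.qParam 1 (w : ℂ)) = H w :=
    eq_cuspFunction w one_ne_zero hper
  by_contra hne
  have hne' : ¬ ∀ᶠ q in 𝓝 (0 : ℂ), cuspFunction 1 H q = 0 := fun h =>
    hne ((hq.eventually h).mono fun w hw => by rwa [hHq] at hw)
  -- n is the order of vanishing of H in q. Since the Hauptmodul has a simple pole, its n-th power
  -- brings H to the nonzero limit g 0.
  obtain ⟨n, g, hg, hg0, hgH⟩ := han.exists_eventuallyEq_pow_smul_nonzero_iff.mpr hne'
  have hlim : Tendsto (fun w => H w * hauptmodul t w ^ n) atImInfty (𝓝 (g 0)) := by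
    have h1 : Tendsto (fun w : ℍ => g (Function.Periodic.qParam 1 (w : ℂ)) *
        (hauptmodul t w * expo w) ^ n) atImInfty (𝓝 (g 0 * 1 ^ n)) :=
      (hg.continuousAt.tendsto.comp hq).mul ((tendsto_hauptmodul ht).pow n)
    rw [one_pow, mul_one] at h1
    refine h1.congr' ((hq.eventually hgH).mono fun w hw => ?_)
    rw [hHq] at hw
    have hqe : Function.Periodic.qParam 1 (w : ℂ) = expo w := by
      rw [Function.Periodic.qParam, expo]; simp
    simp only [hw, hqe, smul_eq_mul, sub_zero, mul_pow]
    ring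
  let B : Option (ZMod t) → ℍ → ℂ := fun p z => A p z * hauptCusp t p z ^ n
  have hBT (p) (z : ℍ) : B p (T • z) = B (shiftEquiv t p) z := by
    simp only [B, hT, hauptCusp_T hc ht]
  have hBS (p) (z : ℍ) : B p (S • z) = (z : ℂ) ^ 2 * B (invEquiv t p) z := by
    simp only [B, hS, hγ, mul_assoc]
  have hB0 : Tendsto (B none) atImInfty (𝓝 0) := by
    have h := h0.mul ((tendsto_hauptCusp_none_zero ht).pow n)
    rwa [zero_mul] at h
  have hBx (x : ZMod t) : Tendsto (B (some x)) atImInfty (𝓝 (g 0)) := by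
    refine (hlim.comp (tendsto_affPoint (t := t) (x.val : ℤ))).congr fun z => ?_
    rw [apply_some_eq hBT x z]
    simp only [B, Function.comp_apply, hauptCusp_zero_mulPoint, hH]
  -- The t finite points contribute g 0 each and ∞ contributes 0, yet the sum is a level one form of
  -- weight 2.
  have hQ : Tendsto (fun z => ∑ p, B p z) atImInfty (𝓝 (t * g 0)) := by
    have h : Tendsto (fun z => B none z + ∑ x, B (some x) z) atImInfty
        (𝓝 (0 + ∑ _x : ZMod t, g 0)) := hB0.add (tendsto_finsetSum _ fun x _ => hBx x)
    simpa [Fintype.sum_option, ZMod.card] using h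
  have hQ0 : (fun z => ∑ p, B p z) = 0 := by
    refine eq_zero_of_weight_two (Hol.sum _ fun p => (hA p).mul ((hol_hauptCusp p).pow n))
      (fun z => ?_) (fun z => ?_) (hQ.isBigO_one ℝ)
    · simp only [hBT]
      exact Equiv.sum_comp (shiftEquiv t) fun p => B p z
    · simp only [hBS, ← Finset.mul_sum]
      rw [Equiv.sum_comp (invEquiv t) fun p => B p z]
  rw [hQ0] at hQ
  have := tendsto_nhds_unique hQ tendsto_const_nhds
  exact mul_ne_zero (natCast_ne_zero t) hg0 this

/-! ### Expansions of the sums over finite points. -/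

lemma hasShiftedExpansion_some {m : ℤ} {k : ℤ → ℂ} {β : ℤ → ℂ}
    (hβ : HasShiftedExpansion
      (fun z => eisTwo t z * (hauptmodulPoly t m k z / eta (z : ℂ))) m β)
    (y : ZMod t) :
    HasShiftedExpansion
      (fun w => formCusp t m k (some y) (mulPoint t w) / etaCusp t (some y) (mulPoint t w)) m
      fun n => β n *
        ZMod.stdAddChar (((24 * n - 1 : ℤ) : ZMod t) * (24 : ZMod t)⁻¹ * y) := by
  have h := hβ.comp (φ := fun w => affPoint t (lift24 t y) (mulPoint t w))
    (s := (lift24 t y : ℂ) / t) fun w => by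
      rw [coe_affPoint, coe_mulPoint]
      have := natCast_ne_zero t
      field_simp
  simp only [expo_lift24] at h
  intro w
  have := h w
  dsimp only at this ⊢
  rwa [formCusp_some, etaCusp, mul_div_assoc]

lemma hasShiftedExpansion_sum {m : ℤ} {k : ℤ → ℂ} {β : ℤ → ℂ}
    (hβ : HasShiftedExpansion
      (fun z => eisTwo t z * (hauptmodulPoly t m k z / eta (z : ℂ))) m β) : HasShiftedExpansion
    (fun w => ∑ y, formCusp t m k (some y) (mulPoint t w) / etaCusp t (some y) (mulPoint t w)) m
      fun n => β n * if ((24 * n - 1 : ℤ) : ZMod t) * (24 : ZMod t)⁻¹ = 0 then (t : ℂ) else 0 := by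
  intro w
  refine (HasShiftedExpansion.sum Finset.univ (hasShiftedExpansion_some hβ) w).congr_fun
    fun n => ?_
  dsimp only
  rw [← Finset.mul_sum]
  split_ifs with h
  · simp only [h, zero_mul, AddChar.map_zero_eq_one]
    simp [ZMod.card]
  · rw [sum_stdAddChar_mul h]

lemma hasShiftedExpansion_proj {m : ℤ} {k : ℤ → ℂ} {β : ℤ → ℂ}
    (hβ : HasShiftedExpansion
      (fun z => eisTwo t z * (hauptmodulPoly t m k z / eta (z : ℂ))) m β)
    (h2 : t ≠ 2) (κ l : ℂ) : HasShiftedExpansion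
    (fun w => ∑ y, projMatrix κ l (some 0) (some y) *
      (formCusp t m k (some y) (mulPoint t w) / etaCusp t (some y) (mulPoint t w))) m
      fun n => β n * (1 - l * (quadChar t (24 : ZMod t)⁻¹ * quadGauss t) *
        quadChar t ((1 - 24 * n : ℤ) : ZMod t)) := by
  intro w
  refine (HasShiftedExpansion.sum Finset.univ (fun y =>
    (hasShiftedExpansion_some hβ y).const_mul (projMatrix κ l (some 0) (some y))) w).congr_fun
    fun n => ?_
  congr 1
  set a : ZMod t := ((24 * n - 1 : ℤ) : ZMod t) * (24 : ZMod t)⁻¹ with ha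
  -- The sign in χ(-y) comes from the row of 0, whose entries are χ(0 - y); it turns 24n - 1 into 1
  -- - 24n.
  have h1 : ∑ y : ZMod t, quadChar t (-y) * ZMod.stdAddChar (a * y) =
      quadChar t (24 : ZMod t)⁻¹ * quadChar t ((1 - 24 * n : ℤ) : ZMod t) * quadGauss t := by
    rw [← Equiv.sum_comp (Equiv.neg (ZMod t))]
    simp only [Equiv.neg_apply, neg_neg]
    have := sum_quadChar_mul h2 (-a)
    rw [show -a = (24 : ZMod t)⁻¹ * ((1 - 24 * n : ℤ) : ZMod t) by rw [ha]; push_cast; ring,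
      map_mul] at this
    rw [← this, show (24 : ZMod t)⁻¹ * ((1 - 24 * n : ℤ) : ZMod t) = -a by
      rw [ha]; push_cast; ring]
    simp only [mul_neg, neg_mul]
  have h3 (y : ZMod t) : projMatrix κ l (some 0) (some y) *
      (β n * (ZMod.stdAddChar (a * y) : ℂ)) =
      β n * ((if (0 : ZMod t) = y then (1 : ℂ) else 0) * ZMod.stdAddChar (a * y) -
        l * (quadChar t (-y) * ZMod.stdAddChar (a * y))) := by
    simp only [projMatrix, conf, Option.some_inj, zero_sub]
    ring
  dsimp only
  rw [← ha, Finset.sum_congr rfl fun y _ => h3 y, ← Finset.mul_sum, Finset.sum_sub_distrib, ← Finset.mul_sum, h1]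
  simp
  left; ring

/-! ### Conclusion. -/

theorem coeff_eq_zero (ht : t = 5 ∨ t = 7 ∨ t = 13)
    (m : ℤ) (hm : m < 0) (hmt : ¬ 24 * m ≡ 1 [ZMOD (t : ℤ)])
    (k : ℤ → ℂ) (β : ℤ → ℂ)
    (hβ : HasShiftedExpansion (fun z => eisTwo t z * (hauptmodulPoly t m k z / eta (z : ℂ))) m β)
    (hk : ∀ n : ℤ, m + 1 ≤ n → n ≤ -1 → β n = 0) (n : ℤ) (hn : m ≤ n)
    (hleg : legendreSym t (1 - 24 * n) = -legendreSym t (1 - 24 * m)) : β n = 0 := by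
  have h2 : t ≠ 2 := by omega
  have hc : t.Coprime 24 := by rcases ht with rfl | rfl | rfl <;> norm_num
  have htd : t - 1 ∣ 24 := by rcases ht with rfl | rfl | rfl <;> norm_num
  have h24 : t < 24 := by omega
  obtain ⟨ν, hn1, h01, hν⟩ := exists_etaMultiplier (t := t) hc
  obtain ⟨hχ, hr1, hκ⟩ := (etaMultiplier_of_transform hc hn1 h01 hν).eq_quadChar ht
  set κ := ν (some 1) with hκdef
  have hr (p) : ν p ^ (24 / (t - 1)) = 1 := by
    rcases p with _ | x
    · rw [hn1, one_pow]
    · by_cases hx : x = 0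
      · rw [hx, h01, one_pow]
      · have he : Even (24 / (t - 1)) := by rcases ht with rfl | rfl | rfl <;> decide
        obtain ⟨r, hr⟩ := he
        have hq : quadChar t x ^ (24 / (t - 1)) = 1 := by
          rw [hr, ← two_mul, pow_mul, sq, quadChar_mul_self hx, one_pow]
        rw [hχ x hx, mul_pow, hr1, hq, one_mul]
  set ε : ℂ := quadChar t ((1 - 24 * m : ℤ) : ZMod t) with hε
  have hm0 : ((1 - 24 * m : ℤ) : ZMod t) ≠ 0 := by
    rw [Ne, ZMod.intCast_zmod_eq_zero_iff_dvd]
    exact fun h => hmt (Int.modEq_iff_dvd.mpr h)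
  have hεε : ε * ε = 1 := quadChar_mul_self hm0
  have h240 := isUnit_24 hc
  have hc0 : quadChar t (24 : ZMod t)⁻¹ * quadGauss t ≠ 0 := by
    refine mul_ne_zero (fun h => ?_) (quadGauss_ne_zero h2)
    have := quadChar_mul_self (inv_ne_zero h240)
    rw [h] at this
    simp at this
  -- This l turns the factor in `hasShiftedExpansion_proj` into 1 - ε χ(1 - 24n), which is 0 at n =
  -- m.
  set l : ℂ := ε / (quadChar t (24 : ZMod t)⁻¹ * quadGauss t) with hl
  have hlε : l * (quadChar t (24 : ZMod t)⁻¹ * quadGauss t) = ε := div_mul_cancel₀ _ hc0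
  set D := projMatrix (t := t) κ l
  have hproj := hasShiftedExpansion_proj hβ h2 κ l
  rw [hlε] at hproj
  have hnone := tendsto_formCusp_none htd h24 hm k
  -- the member at the cusp `0`
  set Fm : ℍ → ℂ := fun w => ∑ y, D (some 0) (some y) *
      (formCusp t m k (some y) (mulPoint t w) / etaCusp t (some y) (mulPoint t w)) with hFm
  have hH (w : ℍ) : combCusp t D m k (some 0) (mulPoint t w) = eta w * (Fm w - l * κ *
      (formCusp t m k none (mulPoint t w) / etaCusp t none (mulPoint t w))) := by
    rw [combCusp, etaCusp_zero_mulPoint, Fintype.sum_option, hFm]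
    have : D (some 0) none = - (l * κ) := by simp [D, projMatrix, conf]
    rw [this]; ring
  have heta0 : Tendsto (fun z : ℍ => eta z) atImInfty (𝓝 0) := by
    have h := tendsto_eta_div_expo.mul (tendsto_expo_mul (a := 1 / 24) (by norm_num))
    rw [mul_zero] at h
    refine h.congr fun z => ?_
    rw [show ((1 / 24 : ℝ) : ℂ) * z = (z : ℂ) / 24 by push_cast; ring]
    exact div_mul_cancel₀ _ (expo_ne_zero _)
  have hq0 (w : ℍ) : qShift 0 w * expo ((w : ℂ) / 24) = 1 := by
    rw [qShift_eq, ← expo_add, show (((0 : ℤ) : ℂ) - 1 / 24) * w + w / 24 = 0 by push_cast; ring,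
      expo_zero]
  -- No term with n < 0 survives, and the remaining q^(-1/24) is absorbed by η(w).
  have hbdd : IsBoundedAtImInfty fun w => combCusp t D m k (some 0) (mulPoint t w) := by
    have h1 := hproj.tendsto hm.le fun i hi hlt => by
      rcases hi.eq_or_lt with rfl | hlt'
      · rw [← hε, hεε]; ring
      · rw [hk i (by omega) (by omega), zero_mul]
    have h3 := (tendsto_eta_div_expo.mul h1).sub
      ((heta0.mul (hnone.comp (tendsto_mulPoint (t := t)))).const_mul (l * κ))
    refine (h3.congr fun w => ?_).isBigO_one ℝ
    rw [hH]
    have e1 := expo_ne_zero ((w : ℂ) / 24)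
    have e2 : qShift 0 w = (expo ((w : ℂ) / 24))⁻¹ := eq_inv_of_mul_eq_one_left (hq0 w)
    rw [e2]
    simp only [Function.comp_apply]
    field_simp
  -- Summing over y retains only n with 24n ≡ 1 mod t, which excludes n = m by hypothesis and also n
  -- = 0; the other negative n are excluded by `hk`.
  have hzero : Tendsto (combCusp t D m k none) atImInfty (𝓝 0) := by
    have hs := (hasShiftedExpansion_sum hβ).tendsto hm.le fun i hi hlt => by
      rcases hi.eq_or_lt with rfl | hlt'
      · rw [if_neg, mul_zero]
        refine mul_ne_zero (fun h => hm0 ?_) (inv_ne_zero h240)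
        rw [← neg_eq_zero, ← h]; push_cast; ring
      · rw [hk i (by omega) (by omega), zero_mul]
    rw [if_neg (mul_ne_zero (by simp) (inv_ne_zero h240)), mul_zero] at hs
    -- At tw the eta function of ∞ has size q^(t²/24), which beats q^(-1/24).
    have hqe : Tendsto (fun w => etaCusp t none (mulPoint t w) * qShift 0 w) atImInfty (𝓝 0) := by
      have h := ((tendsto_etaCusp_none_div (t := t)).comp (tendsto_mulPoint (t := t))).mul
        (tendsto_expo_mul (a := (t : ℝ) ^ 2 / 24 - 1 / 24) (by
          have : (1 : ℝ) < t := by exact_mod_cast (Fact.out : t.Prime).one_lt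
          nlinarith))
      rw [mul_zero] at h
      refine h.congr fun w => ?_
      have e1 := expo_ne_zero ((t : ℂ) / 24 * (mulPoint t w))
      rw [Function.comp_apply, qShift_eq, show (((t : ℝ) ^ 2 / 24 - 1 / 24 : ℝ) : ℂ) * w =
        (t : ℂ) / 24 * (mulPoint t w) + (((0 : ℤ) : ℂ) - 1 / 24) * w by
          rw [coe_mulPoint]; push_cast; ring, expo_add, ← mul_assoc, div_mul_cancel₀ _ e1]
    have h3 := (((tendsto_etaCusp_none (t := t)).mul hnone).comp (tendsto_mulPoint (t := t))).sub
      ((hqe.mul hs).const_mul (l * κ))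
    simp only [mul_zero, sub_zero] at h3
    have h4 : Tendsto (fun w => combCusp t D m k none (mulPoint t w)) atImInfty (𝓝 0) := by
      refine h3.congr fun w => ?_
      have e1 : qShift 0 w ≠ 0 := left_ne_zero_of_mul_eq_one (hq0 w)
      rw [combCusp, Fintype.sum_option]
      have d1 : D none none = 1 := by simp [D, projMatrix, conf]
      have d2 (y : ZMod t) : D none (some y) = -(l * κ) := by simp [D, projMatrix, conf]
      simp only [d1, d2, Function.comp_apply, ← Finset.mul_sum]
      rw [mul_assoc (etaCusp t none (mulPoint t w)), mul_div_cancel₀ _ e1]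
      ring
    refine (h4.comp (tendsto_affPoint (t := t) 0)).congr fun z => ?_
    rw [Function.comp_apply]
    congr 1
    ext1
    rw [coe_mulPoint_affPoint]; simp
  have hev := eventually_eq_zero_of_permuted hc htd (hauptCusp_S hν hr)
    (hol_combCusp D m k) (combCusp_T hc htd (projMatrix_shift κ l) m k)
    (combCusp_S hν hc hr (projMatrix_inv l hn1 h01 hχ hκ) m k) hbdd hzero
  -- compare with the translate by `24 / t`
  have hfT (z : ℍ) : formCusp t m k none (T ^ 24 • z) / etaCusp t none (T ^ 24 • z) =
      formCusp t m k none z / etaCusp t none z := by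
    have h (i : ℕ) : formCusp t m k none (T ^ i • z) = formCusp t m k none z ∧
        etaCusp t none (T ^ i • z) = expo ((t : ℂ) / 24) ^ i * etaCusp t none z := by
      induction i with
      | zero => simp
      | succ i ih =>
        rw [pow_succ', mul_smul, formCusp_T hc htd, etaCusp_T hc, shiftEquiv_none, ih.1, ih.2]
        exact ⟨rfl, by ring⟩
    rw [(h 24).1, (h 24).2, expo_pow, show ((24 : ℕ) : ℂ) * ((t : ℂ) / 24) = ((t : ℤ) : ℂ) by
      push_cast; ring, expo_int, one_mul]
  set φ : ℍ → ℍ := fun w => affPoint t 24 (mulPoint t w) with hφ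
  have hφc (w : ℍ) : (φ w : ℂ) = w + 24 / t := by
    rw [hφ, coe_affPoint, coe_mulPoint]
    have := natCast_ne_zero t
    push_cast; field_simp
  have hφT (w : ℍ) : mulPoint t (φ w) = T ^ 24 • mulPoint t w := by
    ext1
    have := modular_T_zpow_smul (mulPoint t w) 24
    rw [show (24 : ℤ) = ((24 : ℕ) : ℤ) by rfl, zpow_natCast] at this
    rw [this, UpperHalfPlane.coe_vadd, hφ, coe_mulPoint_affPoint]
    push_cast; ring
  have hφt : Tendsto φ atImInfty atImInfty := (tendsto_affPoint 24).comp tendsto_mulPoint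
  have hFe (w : ℍ) (hw : combCusp t D m k (some 0) (mulPoint t w) = 0) : Fm w = l * κ *
      (formCusp t m k none (mulPoint t w) / etaCusp t none (mulPoint t w)) := by
    rw [hH] at hw
    exact sub_eq_zero.mp ((mul_eq_zero.mp hw).resolve_left (eta_coe_ne_zero w))
  -- The n-th coefficient of this difference is that of `hproj` times e((24n - 1)/t) - 1.
  have hfin := ((hproj.comp hφc).sub hproj).eq_zero (by
    filter_upwards [hev, hφt.eventually hev] with w hw hw'
    have e1 := hFe w hw
    have e2 := hFe (φ w) hw'
    rw [hφT, hfT, ← e1] at e2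
    exact sub_eq_zero.mpr e2) n hn
  have hχn : quadChar t ((1 - 24 * n : ℤ) : ZMod t) = -ε := by
    rw [hε, quadChar_apply, quadChar_apply]
    exact_mod_cast hleg
  have hnt : ¬ (t : ℤ) ∣ 24 * n - 1 := by
    intro h
    have : ((1 - 24 * n : ℤ) : ZMod t) = 0 := by
      rw [ZMod.intCast_zmod_eq_zero_iff_dvd, ← dvd_neg, neg_sub]; exact h
    rw [this, MulChar.map_zero, zero_eq_neg] at hχn
    rw [hχn] at hεε
    simp at hεε
  have hexp : expo (((n : ℂ) - 1 / 24) * (24 / t)) ≠ 1 := by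
    intro h
    rw [expo, Complex.exp_eq_one_iff] at h
    obtain ⟨i, hi⟩ := h
    refine hnt ⟨i, ?_⟩
    have hpi : (2 * (Real.pi : ℂ) * Complex.I) ≠ 0 := Complex.two_pi_I_ne_zero
    have h1 : ((n : ℂ) - 1 / 24) * (24 / t) = i := mul_left_cancel₀ hpi (by rw [hi]; ring)
    have h3 := natCast_ne_zero t
    have h4 : (24 * n - 1 : ℂ) = t * i := by rw [← h1]; field_simp
    exact_mod_cast h4
  rw [hχn] at hfin
  have : β n * (1 - ε * -ε) * (expo (((n : ℂ) - 1 / 24) * (24 / t)) - 1) = 0 := by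
    linear_combination hfin
  rw [show (1 : ℂ) - ε * -ε = 2 by linear_combination hεε] at this
  exact (mul_eq_zero.mp ((mul_eq_zero.mp this).resolve_right (sub_ne_zero.mpr hexp))).resolve_right
    two_ne_zero

end EisensteinEta

end

theorem proposition3p2 (t : ℕ) [Fact t.Prime] (ht : t = 5 ∨ t = 7 ∨ t = 13)
    (m : ℤ) (hm : m < 0) (hmt : ¬ 24 * m ≡ 1 [ZMOD (t : ℤ)])
    (k : ℤ → ℂ) (β : ℤ → ℂ)
    (hβ : EisensteinEta.HasShiftedExpansion
      (fun z => EisensteinEta.eisTwo t z *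
        (EisensteinEta.hauptmodulPoly t m k z / ModularForm.eta (z : ℂ))) m β)
    (hk : ∀ n : ℤ, m + 1 ≤ n → n ≤ -1 → β n = 0) :
    ∀ n : ℤ, m ≤ n →
      legendreSym t (1 - 24 * n) = -legendreSym t (1 - 24 * m) → β n = 0 := by
  exact fun n hn h => EisensteinEta.coeff_eq_zero ht m hm hmt k β hβ hk n hn h
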